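/- Let $\alpha_1,A_1,A_2>0$, let $$T(x,y)=\left(\frac{\alpha_1}{A_1+y},\ \frac{y}{A_2+x}\right),$$ and consider the system $x_{n+1}=\frac{\alpha_1}{A_1+y_n}$, $y_{n+1}=\frac{y_n}{A_2+x_n}$, $n=0,1,\dots$, that is $(x_{n+1},y_{n+1})=T(x_n,y_n)$, with arbitrary initial conditions $(x_0,y_0)\in[0,\infty)^2$. Equilibria are the fixed points of $T$ in $[0,\infty)^2$; an equilibrium is a saddle point if the Jacobian of $T$ there has an eigenvalue of modulus less than $1$ and one of modulus greater than $1$, and it is nonhyperbolic if the Jacobian has an eigenvalue of modulus $1$. The basin of attraction of an equilibrium (for a saddle point also called its stable manifold) is the set of initial conditions whose orbits converge to it. We write $\lim_{n\to\infty}(x_n,y_n)=(0,\infty)$ if $x_n\to0$ and $y_n\to\infty$. 1. If $A_2\ge 1$, then $\left(\frac{\alpha_1}{A_1},0\right)$ is the unique equilibrium, and it is globally asymptotically stable: it is Lyapunov stable and attracts every orbit in $[0,\infty)^2$. 2. If $A_2+\frac{\alpha_1}{A_1}<1$, then the unique equilibrium $\left(\frac{\alpha_1}{A_1},0\right)$ is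 a saddle point with stable manifold $[0,\infty)\times\{0\}$. Whenever $(x_0,y_0)\notin[0,\infty)\times\{0\}$, $\lim_{n\to\infty}(x_n,y_n)=(0,\infty)$. 3. If $A_2+\frac{\alpha_1}{A_1}=1$, then the unique equilibrium $\left(\frac{\alpha_1}{A_1},0\right)$ is nonhyperbolic with basin of attraction $[0,\infty)\times\{0\}$. Whenever $(x_0,y_0)\notin[0,\infty)\times\{0\}$, $\lim_{n\to\infty}(x_n,y_n)=(0,\infty)$. 4. If $A_2+\frac{\alpha_1}{A_1}>1$ and $A_2<1$, then there are exactly two equilibria, $\left(\frac{\alpha_1}{A_1},0\right)$ and $\bar z=\left(1-A_2,\frac{\alpha_1}{1-A_2}-A_1\right)$. The equilibrium $\left(\frac{\alpha_1}{A_1},0\right)$ is locally asymptotically stable, and $\bar z$ is a saddle point. Moreover, there is a strictly increasing $C^\infty$ function $C:(0,\infty)\to(0,\infty)$ whose graph is the stable manifold of $\bar z$ in $(0,\infty)^2$, that is, the set of points of $(0,\infty)^2$ whose orbits converge to $\bar z$. The graph is also an invariant separatrix for the positive solutions: $T$ maps the graph into itself, and the complement of the graph in $(0,\infty)^2$ has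 exactly the two connected components $\{y>C(x)\}$ and $\{y<C(x)\}$, each mapped into itself by $T$. For $x_0>0$ and $y_0\ge0$: - if $y_0>C(x_0)$, then $\lim_{n\to\infty}(x_n,y_n)=(0,\infty)$; - if $y_0=C(x_0)$, then $\lim_{n\to\infty}(x_n,y_n)=\bar z$; - if $y_0<C(x_0)$, then $\lim_{n\to\infty}(x_n,y_n)=\left(\frac{\alpha_1}{A_1},0\right)$. For $x_0=0$ and $y_0\ge 0$ (so that $x_1>0$), the same three implications hold with $(x_1,y_1)$ in place of $(x_0,y_0)$ in the hypotheses $y_0>C(x_0)$, $y_0=C(x_0)$, $y_0<C(x_0)$. -/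

import Mathlib

open Set Filter Topology
open scoped ContDiff

/-- The map `T(x, y) = (α₁ / (A₁ + y), y / (A₂ + x))` of the system
`x_{n+1} = α₁ / (A₁ + y_n)`, `y_{n+1} = y_n / (A₂ + x_n)`. The solution with initial condition
`p = (x₀, y₀)` is `n ↦ (systemMap α₁ A₁ A₂)^[n] p`. -/
noncomputable def systemMap (α₁ A₁ A₂ : ℝ) (p : ℝ × ℝ) : ℝ × ℝ :=
  (α₁ / (A₁ + p.2), p.2 / (A₂ + p.1))

/-- The set `[0, ∞)²` of admissible initial conditions. -/
def closedQuadrant : Set (ℝ × ℝ) := {p | 0 ≤ p.1 ∧ 0 ≤ p.2}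

/-- The open quadrant `(0, ∞)²`. -/
def openQuadrant : Set (ℝ × ℝ) := {p | 0 < p.1 ∧ 0 < p.2}

/-- The half-line `[0, ∞) × {0}`. -/
def horizontalAxis : Set (ℝ × ℝ) := {p | 0 ≤ p.1 ∧ p.2 = 0}

/-- The equilibria (fixed points) of `T` in `D`. -/
def equilibria (T : ℝ × ℝ → ℝ × ℝ) (D : Set (ℝ × ℝ)) : Set (ℝ × ℝ) := {p ∈ D | T p = p}

/-- The basin of attraction of `z` in `D`. -/
def basin (T : ℝ × ℝ → ℝ × ℝ) (D : Set (ℝ × ℝ)) (z : ℝ × ℝ) : Set (ℝ × ℝ) :=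
  {p ∈ D | Tendsto (fun n : ℕ => T^[n] p) atTop (𝓝 z)}

/-- The (global) stable manifold in `D` of a saddle point `z`: the points of `D` whose forward
orbit converges to `z`. -/
def stableManifold (T : ℝ × ℝ → ℝ × ℝ) (D : Set (ℝ × ℝ)) (z : ℝ × ℝ) : Set (ℝ × ℝ) :=
  {p ∈ D | Tendsto (fun n : ℕ => T^[n] p) atTop (𝓝 z)}

/-- The orbit of `p` tends to `(0, ∞)`. -/
def TendsToZeroInfinity (T : ℝ × ℝ → ℝ × ℝ) (p : ℝ × ℝ) : Prop :=
  Tendsto (fun n : ℕ => (T^[n] p).1) atTop (𝓝 0) ∧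
    Tendsto (fun n : ℕ => (T^[n] p).2) atTop atTop

/-- `z` is a (Lyapunov) stable equilibrium of `T` on `D`. -/
def IsLocallyStable (T : ℝ × ℝ → ℝ × ℝ) (D : Set (ℝ × ℝ)) (z : ℝ × ℝ) : Prop :=
  z ∈ equilibria T D ∧
    ∀ ε > 0, ∃ δ > 0, ∀ p ∈ D, dist p z < δ → ∀ n : ℕ, dist (T^[n] p) z < ε

/-- `z` is a locally asymptotically stable equilibrium of `T` on `D`. -/
def IsLocallyAsymptoticallyStable (T : ℝ × ℝ → ℝ × ℝ) (D : Set (ℝ × ℝ)) (z : ℝ × ℝ) : Prop :=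
  IsLocallyStable T D z ∧
    ∃ δ > 0, ∀ p ∈ D, dist p z < δ → Tendsto (fun n : ℕ => T^[n] p) atTop (𝓝 z)

/-- `z` is a globally asymptotically stable equilibrium of `T` on `D`. -/
def IsGloballyAsymptoticallyStable (T : ℝ × ℝ → ℝ × ℝ) (D : Set (ℝ × ℝ)) (z : ℝ × ℝ) : Prop :=
  IsLocallyStable T D z ∧ ∀ p ∈ D, Tendsto (fun n : ℕ => T^[n] p) atTop (𝓝 z)

/-- The complex eigenvalues of the Jacobian of `T` at `z`. -/
noncomputable def jacobianEigenvalues (T : ℝ × ℝ → ℝ × ℝ) (z : ℝ × ℝ) : Set ℂ :=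
  {μ | Polynomial.aeval μ (fderiv ℝ T z : ℝ × ℝ →ₗ[ℝ] ℝ × ℝ).charpoly = 0}

/-- `z` is a saddle point of `T`: a hyperbolic fixed point whose Jacobian has eigenvalues both
inside and outside the unit circle. -/
def IsSaddle (T : ℝ × ℝ → ℝ × ℝ) (z : ℝ × ℝ) : Prop :=
  T z = z ∧ DifferentiableAt ℝ T z ∧ (∀ μ ∈ jacobianEigenvalues T z, ‖μ‖ ≠ 1) ∧
    (∃ μ ∈ jacobianEigenvalues T z, ‖μ‖ < 1) ∧ (∃ μ ∈ jacobianEigenvalues T z, 1 < ‖μ‖)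

/-- `z` is a nonhyperbolic fixed point of `T`: the Jacobian has an eigenvalue on the unit
circle. -/
def IsNonhyperbolic (T : ℝ × ℝ → ℝ × ℝ) (z : ℝ × ℝ) : Prop :=
  T z = z ∧ DifferentiableAt ℝ T z ∧ ∃ μ ∈ jacobianEigenvalues T z, ‖μ‖ = 1

/-- `S` is an invariant separatrix of `T` in `D`: it is invariant, and it cuts `D` into two
connected components `U` and `V`, each of which is invariant. -/
structure IsInvariantSeparatrix (T : ℝ × ℝ → ℝ × ℝ) (D S U V : Set (ℝ × ℝ)) : Prop where
  subset : S ⊆ D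
  mapsTo : MapsTo T S S
  diff_eq : D \ S = U ∪ V
  disjoint : Disjoint U V
  isOpen_left : IsOpen U
  isOpen_right : IsOpen V
  isConnected_left : IsConnected U
  isConnected_right : IsConnected V
  mapsTo_left : MapsTo T U U
  mapsTo_right : MapsTo T V V

/-!
The second coordinates of an orbit satisfy `y (n + 2) = y (n + 1) / (B + α / (A + y n))`, in which
the growth factor increases with `y n`. Hence two consecutive second coordinates on the same side of
the critical level force geometric growth or geometric decay. This settles everything except
orbits that keep changing sides of the interior equilibrium `e = α / (1 - B) - A`. For these, the
deviations `Y n = log (y n / e)` satisfy `|Y (n + 2) - Y (n + 1)| ≤ |Y n|` with `Y (n + 2)` and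
`Y (n + 1)` of opposite signs, so `|Y (n + 2)| + |Y (n + 1)| ≤ |Y n|`, and telescoping gives
convergence to the interior equilibrium (`trichotomy`).

On every vertical half-line escape and extinction are nonempty open conditions, so by connectedness
some point `(x, C x)` satisfies neither. The map is competitive, and ratios of second coordinates
of ordered orbits never decrease (`comparison`); this makes `C x` unique and `C` strictly
increasing, and identifies the regions above and below the graph with the two other basins.

For smoothness, orbits are encoded as zeros of a polynomial map on the Banach algebra of bounded
sequences (`orbitDefect`), and the inverse function theorem is applied at the orbit of `(x₀, C x₀)`.
The derivative is bijective because, after normalization, the linearized recurrence is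
`η (n + 2) = η (n + 1) + d n * η n + h n` with `0 < δ ≤ d n ≤ D < 1`: nonzero homogeneous solutions
with `η 0 = 0` are unbounded, while a shooting argument yields a bounded solution for every bounded
right-hand side and every initial value (`exists_bounded_solution`). Zeros of the defect near the
given orbit are bounded and bounded away from extinction, so they lie on the graph of `C`.
-/

/-! ### Orbits in coordinates -/

section Orbits

variable {α A B : ℝ}

theorem systemMap_mem_closedQuadrant (hα : 0 < α) (hA : 0 < A) (hB : 0 < B) {p : ℝ × ℝ}
    (hp : p ∈ closedQuadrant) : systemMap α A B p ∈ closedQuadrant := by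
  obtain ⟨h1, h2⟩ := hp
  exact ⟨by simp only [systemMap]; positivity, by simp only [systemMap]; positivity⟩

theorem systemMap_mem_openQuadrant (hα : 0 < α) (hA : 0 < A) (hB : 0 < B) {p : ℝ × ℝ}
    (hp : p ∈ openQuadrant) : systemMap α A B p ∈ openQuadrant := by
  obtain ⟨h1, h2⟩ := hp
  exact ⟨by simp only [systemMap]; positivity, by simp only [systemMap]; positivity⟩

theorem openQuadrant_subset_closedQuadrant : openQuadrant ⊆ closedQuadrant :=
  fun _ h => ⟨h.1.le, h.2.le⟩

theorem iterate_mem_closedQuadrant (hα : 0 < α) (hA : 0 < A) (hB : 0 < B) {p : ℝ × ℝ}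
    (hp : p ∈ closedQuadrant) (n : ℕ) : (systemMap α A B)^[n] p ∈ closedQuadrant :=
  MapsTo.iterate (fun _ h => systemMap_mem_closedQuadrant hα hA hB h) n hp

theorem iterate_mem_openQuadrant (hα : 0 < α) (hA : 0 < A) (hB : 0 < B) {p : ℝ × ℝ}
    (hp : p ∈ openQuadrant) (n : ℕ) : (systemMap α A B)^[n] p ∈ openQuadrant :=
  MapsTo.iterate (fun _ h => systemMap_mem_openQuadrant hα hA hB h) n hp

theorem iterate_succ_fst (p : ℝ × ℝ) (n : ℕ) :
    ((systemMap α A B)^[n + 1] p).1 = α / (A + ((systemMap α A B)^[n] p).2) := by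
  rw [Function.iterate_succ_apply']; rfl

theorem iterate_succ_snd (p : ℝ × ℝ) (n : ℕ) :
    ((systemMap α A B)^[n + 1] p).2 =
      ((systemMap α A B)^[n] p).2 / (B + ((systemMap α A B)^[n] p).1) := by
  rw [Function.iterate_succ_apply']; rfl

/-- The second coordinates of an orbit satisfy a second order recurrence of their own. -/
theorem iterate_add_two_snd (p : ℝ × ℝ) (n : ℕ) :
    ((systemMap α A B)^[n + 2] p).2 =
      ((systemMap α A B)^[n + 1] p).2 / (B + α / (A + ((systemMap α A B)^[n] p).2)) := by
  rw [iterate_succ_snd, iterate_succ_fst]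

theorem continuousAt_systemMap (hA : 0 < A) (hB : 0 < B) {p : ℝ × ℝ} (hp : p ∈ closedQuadrant) :
    ContinuousAt (systemMap α A B) p := by
  obtain ⟨h1, h2⟩ := hp
  unfold systemMap
  have h3 : A + p.2 ≠ 0 := by positivity
  have h4 : B + p.1 ≠ 0 := by positivity
  fun_prop (disch := assumption)

theorem continuousAt_iterate (hα : 0 < α) (hA : 0 < A) (hB : 0 < B) {p : ℝ × ℝ}
    (hp : p ∈ closedQuadrant) (n : ℕ) : ContinuousAt (systemMap α A B)^[n] p := by
  induction n with
  | zero => exact continuousAt_id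
  | succ n ih =>
    rw [Function.iterate_succ']
    exact (continuousAt_systemMap hA hB (iterate_mem_closedQuadrant hα hA hB hp n)).comp ih

theorem tendsto_iterate_shift {T : ℝ × ℝ → ℝ × ℝ} {p z : ℝ × ℝ} (k : ℕ) :
    Tendsto (fun n : ℕ => T^[n] (T^[k] p)) atTop (𝓝 z) ↔
      Tendsto (fun n : ℕ => T^[n] p) atTop (𝓝 z) := by
  simp only [← Function.iterate_add_apply]
  exact tendsto_add_atTop_iff_nat (f := fun n => T^[n] p) k

theorem tendsToZeroInfinity_shift {T : ℝ × ℝ → ℝ × ℝ} {p : ℝ × ℝ} (k : ℕ) :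
    TendsToZeroInfinity T (T^[k] p) ↔ TendsToZeroInfinity T p := by
  simp only [TendsToZeroInfinity, ← Function.iterate_add_apply]
  exact and_congr (tendsto_add_atTop_iff_nat (f := fun n => (T^[n] p).1) k)
    (tendsto_add_atTop_iff_nat (f := fun n => (T^[n] p).2) k)

/-- The first coordinate of an orbit is a function of the preceding second coordinate, so
convergence of the second coordinates is enough. -/
theorem tendsto_iterate_of_tendsto_snd {p : ℝ × ℝ} {l : ℝ} (hl : A + l ≠ 0)
    (h : Tendsto (fun n : ℕ => ((systemMap α A B)^[n] p).2) atTop (𝓝 l)) :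
    Tendsto (fun n : ℕ => (systemMap α A B)^[n] p) atTop (𝓝 (α / (A + l), l)) := by
  have h1 : Tendsto (fun n : ℕ => ((systemMap α A B)^[n] p).1) atTop (𝓝 (α / (A + l))) := by
    rw [← tendsto_add_atTop_iff_nat 1]
    simp only [iterate_succ_fst]
    exact tendsto_const_nhds.div (tendsto_const_nhds.add h) hl
  exact h1.prodMk_nhds h

end Orbits

/-! ### Escape and extinction -/

section Escape

variable {α A B : ℝ}

/-- If `B + α / (A + t) < 1`, then two consecutive second coordinates at or above `t` force
geometric growth. -/
theorem tendsToZeroInfinity_of_le (hα : 0 < α) (hA : 0 < A) (hB : 0 < B) {t : ℝ} (ht : 0 < t)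
    (hr : B + α / (A + t) < 1) {p : ℝ × ℝ} (hp : p ∈ closedQuadrant) (n : ℕ)
    (h0 : t ≤ ((systemMap α A B)^[n] p).2) (h1 : t ≤ ((systemMap α A B)^[n + 1] p).2) :
    TendsToZeroInfinity (systemMap α A B) p := by
  rw [← tendsToZeroInfinity_shift n]
  replace hp := iterate_mem_closedQuadrant hα hA hB hp n
  rw [add_comm, Function.iterate_add_apply] at h1
  generalize (systemMap α A B)^[n] p = q at *
  set r := B + α / (A + t) with hrdef
  have hr0 : 0 < r := by positivity
  have key : ∀ k, t ≤ ((systemMap α A B)^[k] q).2 ∧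
      t * (1 / r) ^ k ≤ ((systemMap α A B)^[k + 1] q).2 := by
    intro k
    induction k with
    | zero => exact ⟨h0, by simpa using h1⟩
    | succ k ih =>
      obtain ⟨ih1, ih2⟩ := ih
      have h1r : 1 ≤ 1 / r := by rw [le_div_iff₀ hr0]; linarith
      have h3 : t ≤ t * (1 / r) ^ k := le_mul_of_one_le_right ht.le (one_le_pow₀ h1r)
      refine ⟨h3.trans ih2, ?_⟩
      rw [iterate_add_two_snd, pow_succ]
      have h4 : B + α / (A + ((systemMap α A B)^[k] q).2) ≤ r := by
        rw [hrdef]; gcongr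
      have h5 : 0 < B + α / (A + ((systemMap α A B)^[k] q).2) := by
        have : 0 < A + ((systemMap α A B)^[k] q).2 := by linarith
        positivity
      rw [le_div_iff₀ h5]
      calc t * ((1 / r) ^ k * (1 / r)) * (B + α / (A + ((systemMap α A B)^[k] q).2))
          ≤ t * ((1 / r) ^ k * (1 / r)) * r := by gcongr
        _ = t * (1 / r) ^ k := by field_simp
        _ ≤ _ := ih2
  have hy : Tendsto (fun n : ℕ => ((systemMap α A B)^[n] q).2) atTop atTop := by
    rw [← tendsto_add_atTop_iff_nat 1]
    refine tendsto_atTop_mono (fun k => (key k).2) ?_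
    exact (tendsto_pow_atTop_atTop_of_one_lt (by rw [lt_div_iff₀ hr0]; linarith)).const_mul_atTop ht
  refine ⟨?_, hy⟩
  rw [← tendsto_add_atTop_iff_nat 1]
  simp only [iterate_succ_fst]
  exact (tendsto_atTop_add_const_left _ A hy).const_div_atTop α

/-- If `1 < B + α / (A + t)`, then two consecutive second coordinates at or below `t` force
geometric decay. -/
theorem tendsto_extinction_of_le (hα : 0 < α) (hA : 0 < A) (hB : 0 < B) {t : ℝ}
    (hr : 1 < B + α / (A + t)) {p : ℝ × ℝ} (hp : p ∈ closedQuadrant) (n : ℕ)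
    (h0 : ((systemMap α A B)^[n] p).2 ≤ t) (h1 : ((systemMap α A B)^[n + 1] p).2 ≤ t) :
    Tendsto (fun n : ℕ => (systemMap α A B)^[n] p) atTop (𝓝 (α / A, 0)) := by
  rw [← tendsto_iterate_shift n]
  replace hp := iterate_mem_closedQuadrant hα hA hB hp n
  rw [add_comm, Function.iterate_add_apply] at h1
  generalize (systemMap α A B)^[n] p = q at *
  have hnn := fun k => (iterate_mem_closedQuadrant hα hA hB hp k).2
  set r := B + α / (A + t) with hrdef
  have hr0 : 0 < r := by linarith
  have ht : 0 ≤ t := (hnn 0).trans h0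
  have key : ∀ k, ((systemMap α A B)^[k] q).2 ≤ t ∧
      ((systemMap α A B)^[k + 1] q).2 ≤ t * (1 / r) ^ k := by
    intro k
    induction k with
    | zero => exact ⟨h0, by simpa using h1⟩
    | succ k ih =>
      obtain ⟨ih1, ih2⟩ := ih
      have h1r : 1 / r ≤ 1 := by rw [div_le_iff₀ hr0]; linarith
      have h3 : t * (1 / r) ^ k ≤ t :=
        mul_le_of_le_one_right ht (pow_le_one₀ (by positivity) h1r)
      refine ⟨ih2.trans h3, ?_⟩
      rw [iterate_add_two_snd, pow_succ]
      have h6 : 0 < A + ((systemMap α A B)^[k] q).2 := by linarith [hnn k]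
      have h4 : r ≤ B + α / (A + ((systemMap α A B)^[k] q).2) := by
        rw [hrdef]; gcongr
      have h5 : 0 < B + α / (A + ((systemMap α A B)^[k] q).2) := by positivity
      rw [div_le_iff₀ h5]
      calc _ ≤ t * (1 / r) ^ k := ih2
        _ = t * ((1 / r) ^ k * (1 / r)) * r := by field_simp
        _ ≤ _ := by gcongr
  have hy : Tendsto (fun n : ℕ => ((systemMap α A B)^[n] q).2) atTop (𝓝 0) := by
    rw [← tendsto_add_atTop_iff_nat 1]
    refine squeeze_zero (fun k => hnn _) (fun k => (key k).2) ?_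
    have := tendsto_pow_atTop_nhds_zero_of_lt_one (r := 1 / r) (by positivity)
      (by rw [div_lt_iff₀ hr0]; linarith)
    simpa using this.const_mul t
  simpa using tendsto_iterate_of_tendsto_snd (by simpa using hA.ne') hy

theorem iterate_snd_eq_zero {p : ℝ × ℝ} (hp : p.2 = 0) (n : ℕ) :
    ((systemMap α A B)^[n] p).2 = 0 := by
  induction n with
  | zero => exact hp
  | succ n ih => rw [iterate_succ_snd, ih, zero_div]

theorem tendsto_of_snd_eq_zero (hA : 0 < A) {p : ℝ × ℝ} (hp : p.2 = 0) :
    Tendsto (fun n : ℕ => (systemMap α A B)^[n] p) atTop (𝓝 (α / A, 0)) := by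
  have h : Tendsto (fun n : ℕ => ((systemMap α A B)^[n] p).2) atTop (𝓝 0) := by
    simp only [iterate_snd_eq_zero hp, tendsto_const_nhds]
  simpa using tendsto_iterate_of_tendsto_snd (by simpa using hA.ne') h

theorem TendsToZeroInfinity.not_tendsto {T : ℝ × ℝ → ℝ × ℝ} {p z : ℝ × ℝ}
    (h : TendsToZeroInfinity T p) : ¬ Tendsto (fun n : ℕ => T^[n] p) atTop (𝓝 z) := fun h' =>
  not_tendsto_atTop_of_tendsto_nhds ((continuous_snd.tendsto _).comp h') h.2

/-- Below the critical line `B + α / A = 1` every orbit off the horizontal axis escapes. -/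
theorem tendsToZeroInfinity_of_notMem_horizontalAxis (hα : 0 < α) (hA : 0 < A) (hB : 0 < B)
    (h : B + α / A ≤ 1) {p : ℝ × ℝ} (hp : p ∈ closedQuadrant) (hp' : p ∉ horizontalAxis) :
    TendsToZeroInfinity (systemMap α A B) p := by
  have h2 : 0 < p.2 := hp.2.lt_of_ne fun h => hp' ⟨hp.1, h.symm⟩
  have h3 : 0 < ((systemMap α A B)^[1] p).2 := by
    have := hp.1
    simp only [Function.iterate_one, systemMap]; positivity
  refine tendsToZeroInfinity_of_le hα hA hB (lt_min h2 h3) ?_ hp 0 (min_le_left _ _)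
    (min_le_right _ _)
  have : α / (A + min p.2 ((systemMap α A B)^[1] p).2) < α / A := by
    have := lt_min h2 h3
    gcongr; linarith
  linarith

theorem basin_eq_horizontalAxis (hα : 0 < α) (hA : 0 < A) (hB : 0 < B) (h : B + α / A ≤ 1) :
    basin (systemMap α A B) closedQuadrant (α / A, 0) = horizontalAxis := by
  ext p
  refine ⟨fun ⟨hp, ht⟩ => ?_, fun hp => ⟨⟨hp.1, hp.2.ge⟩, tendsto_of_snd_eq_zero hA hp.2⟩⟩
  by_contra hp'
  exact (tendsToZeroInfinity_of_notMem_horizontalAxis hα hA hB h hp hp').not_tendsto ht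

theorem tendsto_of_one_le (hα : 0 < α) (hA : 0 < A) (hB : 1 ≤ B) {p : ℝ × ℝ}
    (hp : p ∈ closedQuadrant) :
    Tendsto (fun n : ℕ => (systemMap α A B)^[n] p) atTop (𝓝 (α / A, 0)) := by
  refine tendsto_extinction_of_le hα hA (by linarith)
    (t := max p.2 ((systemMap α A B)^[1] p).2) ?_ hp 0 (le_max_left _ _) (le_max_right _ _)
  have : 0 < A + max p.2 ((systemMap α A B)^[1] p).2 := by
    have := hp.2.trans (le_max_left p.2 ((systemMap α A B)^[1] p).2)
    linarith
  have : 0 < α / (A + max p.2 ((systemMap α A B)^[1] p).2) := by positivity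
  linarith

end Escape

/-! ### Equilibria and stability on the axis -/

section Equilibria

variable {α A B : ℝ}

theorem systemMap_axis_equilibrium : systemMap α A B (α / A, 0) = (α / A, 0) := by
  simp [systemMap]

theorem systemMap_interior_equilibrium (hα : 0 < α) (hB' : B < 1) :
    systemMap α A B (1 - B, α / (1 - B) - A) = (1 - B, α / (1 - B) - A) := by
  have : 1 - B ≠ 0 := by linarith
  simp only [systemMap, add_sub_cancel, div_one, Prod.mk.injEq, and_true]
  field_simp

theorem eq_of_systemMap_eq (hα : 0 < α) (hA : 0 < A) (hB : 0 < B) {p : ℝ × ℝ}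
    (hp : p ∈ closedQuadrant) (h : systemMap α A B p = p) :
    p = (α / A, 0) ∨ (1 < B + α / A ∧ B < 1 ∧ p = (1 - B, α / (1 - B) - A)) := by
  obtain ⟨x, y⟩ := p
  obtain ⟨hx, hy⟩ := hp
  simp only [systemMap, Prod.mk.injEq] at h hx hy ⊢
  obtain ⟨h1, h2⟩ := h
  rcases hy.eq_or_lt with rfl | hy
  · left; simp at h1; simp [h1]
  · right
    have h3 : B + x ≠ 0 := by positivity
    have h4 : A + y ≠ 0 := by positivity
    have h5 : B + x = 1 := by
      rw [div_eq_iff h3] at h2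
      exact mul_left_cancel₀ hy.ne' (by linarith)
    have hx' : 0 < x := h1 ▸ by positivity
    have h6 : α = x * (A + y) := by rwa [div_eq_iff h4] at h1
    obtain rfl : B = 1 - x := by linarith
    refine ⟨?_, by linarith, by ring, ?_⟩
    · have : x < α / A := by rw [lt_div_iff₀ hA, h6]; nlinarith
      linarith
    · rw [sub_sub_cancel, h6]
      field_simp
      ring

theorem equilibria_eq_singleton (hα : 0 < α) (hA : 0 < A) (hB : 0 < B)
    (h : B + α / A ≤ 1 ∨ 1 ≤ B) :
    equilibria (systemMap α A B) closedQuadrant = {(α / A, 0)} := by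
  ext p
  refine ⟨fun ⟨hp, hT⟩ => ?_, ?_⟩
  · rcases eq_of_systemMap_eq hα hA hB hp hT with h' | ⟨h1, h2, -⟩
    · exact h'
    · rcases h with h | h <;> linarith
  · rintro rfl
    exact ⟨⟨by positivity, le_rfl⟩, systemMap_axis_equilibrium⟩

theorem interior_equilibrium_pos (hA : 0 < A) (h : 1 < B + α / A) (hB' : B < 1) :
    0 < α / (1 - B) - A := by
  have h1 : 0 < 1 - B := by linarith
  have h2 : 1 - B < α / A := by linarith
  rw [lt_div_iff₀ hA] at h2
  rw [sub_pos, lt_div_iff₀ h1]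
  linarith

theorem equilibria_eq_pair (hα : 0 < α) (hA : 0 < A) (hB : 0 < B) (h : 1 < B + α / A)
    (hB' : B < 1) :
    equilibria (systemMap α A B) closedQuadrant = {(α / A, 0), (1 - B, α / (1 - B) - A)} := by
  ext p
  refine ⟨fun ⟨hp, hT⟩ => ?_, ?_⟩
  · rcases eq_of_systemMap_eq hα hA hB hp hT with h' | ⟨-, -, h'⟩
    · exact Or.inl h'
    · exact Or.inr h'
  · rintro (rfl | rfl)
    · exact ⟨⟨by positivity, le_rfl⟩, systemMap_axis_equilibrium⟩
    · exact ⟨⟨by simpa using hB'.le, (interior_equilibrium_pos hA h hB').le⟩,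
        systemMap_interior_equilibrium hα hB'⟩

/-- Near `(α / A, 0)` the second coordinate never increases, and it controls the distance of the
first coordinate from `α / A`. -/
theorem isLocallyAsymptoticallyStable_axis (hα : 0 < α) (hA : 0 < A) (hB : 0 < B)
    (h : 1 < B + α / A) :
    IsLocallyAsymptoticallyStable (systemMap α A B) closedQuadrant (α / A, 0) := by
  -- `t` is a level of the second coordinate below which the next first coordinate exceeds `1 - B`
  obtain ⟨t, ht, hr⟩ : ∃ t > 0, 1 < B + α / (A + t) := by
    have hc : ContinuousAt (fun t => B + α / (A + t)) 0 := by
      have : A + 0 ≠ 0 := by simpa using hA.ne'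
      fun_prop (disch := assumption)
    have h0 : ∀ᶠ t in 𝓝[>] (0 : ℝ), 1 < B + α / (A + t) :=
      (hc.eventually_const_lt (by simpa using h)).filter_mono nhdsWithin_le_nhds
    obtain ⟨t, h1, h2⟩ := (h0.and self_mem_nhdsWithin).exists
    exact ⟨t, h2, h1⟩
  have mono : ∀ p ∈ closedQuadrant, dist p (α / A, 0) < min t (B + α / A - 1) →
      ∀ n, ((systemMap α A B)^[n] p).2 ≤ p.2 ∧ 1 ≤ B + ((systemMap α A B)^[n] p).1 := by
    intro p hp hd n
    rw [lt_min_iff, Prod.dist_eq, max_lt_iff, max_lt_iff, Real.dist_eq, Real.dist_eq] at hd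
    obtain ⟨⟨-, hd1⟩, hd2, -⟩ := hd
    induction n with
    | zero =>
      have := (abs_lt.1 hd2).1
      simp only [Function.iterate_zero, id] at this ⊢
      exact ⟨le_rfl, by linarith⟩
    | succ n ih =>
      obtain ⟨ih1, ih2⟩ := ih
      have hn := (iterate_mem_closedQuadrant hα hA hB hp n).2
      refine ⟨?_, ?_⟩
      · rw [iterate_succ_snd]
        exact (div_le_self hn ih2).trans ih1
      · rw [iterate_succ_fst]
        have h1 : ((systemMap α A B)^[n] p).2 ≤ t := by
          have := (abs_lt.1 hd1).2
          simp only [sub_zero] at this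
          linarith
        have h2 : α / (A + t) ≤ α / (A + ((systemMap α A B)^[n] p).2) := by gcongr
        linarith
  have hm : 0 < min t (B + α / A - 1) := lt_min ht (by linarith)
  have snd_lt : ∀ {δ : ℝ}, ∀ p ∈ closedQuadrant, dist p (α / A, 0) < δ → p.2 < δ := by
    intro δ p hp hd
    rw [Prod.dist_eq, max_lt_iff, Real.dist_eq, Real.dist_eq] at hd
    simpa [abs_of_nonneg hp.2] using hd.2
  refine ⟨⟨⟨⟨by positivity, le_rfl⟩, systemMap_axis_equilibrium⟩, fun ε hε => ?_⟩,
    min t (B + α / A - 1), hm, fun p hp hd => ?_⟩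
  · refine ⟨min (min t (B + α / A - 1)) (min ε (ε * A ^ 2 / α)), by positivity,
      fun p hp hd n => ?_⟩
    rw [lt_min_iff] at hd
    have h1 := (mono p hp hd.1 n).1
    have h2 := snd_lt p hp hd.2
    rw [lt_min_iff] at h2
    have hn := (iterate_mem_closedQuadrant hα hA hB hp n).2
    rw [Prod.dist_eq, max_lt_iff, Real.dist_eq, Real.dist_eq]
    refine ⟨?_, by simpa [abs_of_nonneg hn] using h1.trans_lt h2.1⟩
    cases n with
    | zero =>
      have := hd.2.trans_le (min_le_left _ _)
      rw [Prod.dist_eq, max_lt_iff, Real.dist_eq] at this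
      exact this.1
    | succ n =>
      have h1 := (mono p hp hd.1 n).1
      have hn := (iterate_mem_closedQuadrant hα hA hB hp n).2
      rw [iterate_succ_fst]
      set y := ((systemMap α A B)^[n] p).2
      have h3 : α / (A + y) - α / A = -(α * y / (A * (A + y))) := by
        field_simp; ring
      rw [h3, abs_neg, abs_of_nonneg (by positivity)]
      have h4 : y < ε * A ^ 2 / α := by linarith
      rw [lt_div_iff₀ hα] at h4
      rw [div_lt_iff₀ (by positivity)]
      nlinarith [mul_nonneg (mul_nonneg hε.le hA.le) hn]
  · have h1 := snd_lt p hp hd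
    have h2 : p.2 ≤ t := (h1.trans_le (min_le_left _ _)).le
    exact tendsto_extinction_of_le hα hA hB hr hp 0 h2 ((mono p hp hd 1).1.trans h2)

theorem isGloballyAsymptoticallyStable_axis (hα : 0 < α) (hA : 0 < A) (hB : 1 ≤ B) :
    IsGloballyAsymptoticallyStable (systemMap α A B) closedQuadrant (α / A, 0) :=
  ⟨(isLocallyAsymptoticallyStable_axis hα hA (by linarith)
    (by have : 0 < α / A := by positivity
        linarith)).1, fun _ hp => tendsto_of_one_le hα hA hB hp⟩

end Equilibria

/-! ### Linearization at the equilibria -/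

section Jacobian

variable {α A B : ℝ}

/-- The Jacobian has trace `1 / (B + x)` and determinant `- α y / ((A + y)² (B + x)²)`. -/
theorem mem_jacobianEigenvalues_iff {x y : ℝ} (hy : A + y ≠ 0) (hx : B + x ≠ 0) (μ : ℂ) :
    μ ∈ jacobianEigenvalues (systemMap α A B) (x, y) ↔
      μ ^ 2 - (1 / (B + x) : ℝ) * μ - (α * y / ((A + y) ^ 2 * (B + x) ^ 2) : ℝ) = 0 := by
  have h1 : HasFDerivAt (systemMap α A B)
      (LinearMap.toContinuousLinearMap (Matrix.toLin (Module.Basis.finTwoProd ℝ)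
        (Module.Basis.finTwoProd ℝ)
        !![0, -α / (A + y) ^ 2; -y / (B + x) ^ 2, 1 / (B + x)])) (x, y) := by
    rw [Matrix.toLin_finTwoProd_toContinuousLinearMap]
    have e1 : HasFDerivAt (fun p : ℝ × ℝ => A + p.2) (ContinuousLinearMap.snd ℝ ℝ ℝ) (x, y) :=
      hasFDerivAt_snd.const_add A
    have e2 : HasFDerivAt (fun p : ℝ × ℝ => B + p.1) (ContinuousLinearMap.fst ℝ ℝ ℝ) (x, y) :=
      hasFDerivAt_fst.const_add B
    have e3 := (((hasDerivAt_inv hy).comp_hasFDerivAt (x, y) e1).const_mul α)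
    have e4 := (hasFDerivAt_snd (𝕜 := ℝ) (p := (x, y))).mul
      ((hasDerivAt_inv hx).comp_hasFDerivAt (x, y) e2)
    refine ((e3.prodMk e4).congr_fderiv ?_)
    ext <;> simp <;> ring
  rw [jacobianEigenvalues, mem_ofPred_eq, h1.fderiv, LinearMap.coe_toContinuousLinearMap,
    ← LinearMap.charpoly_toMatrix _ (Module.Basis.finTwoProd ℝ), LinearMap.toMatrix_toLin,
    Matrix.charpoly_fin_two]
  simp only [Matrix.trace_fin_two_of, Matrix.det_fin_two_of, map_add, map_sub, map_mul, map_pow,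
    Polynomial.aeval_X, Polynomial.aeval_C]
  refine Eq.congr_left ?_
  simp only [Complex.coe_algebraMap]
  push_cast
  simp only [div_eq_mul_inv, mul_inv]
  ring

theorem differentiableAt_systemMap {x y : ℝ} (hy : A + y ≠ 0) (hx : B + x ≠ 0) :
    DifferentiableAt ℝ (systemMap α A B) (x, y) := by
  unfold systemMap
  fun_prop (disch := assumption)

theorem mem_jacobianEigenvalues_axis_iff (hA : A ≠ 0) (hB : B + α / A ≠ 0) (μ : ℂ) :
    μ ∈ jacobianEigenvalues (systemMap α A B) (α / A, 0) ↔
      μ = 0 ∨ μ = (1 / (B + α / A) : ℝ) := by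
  rw [mem_jacobianEigenvalues_iff (by simpa using hA) hB]
  have : μ ^ 2 - (1 / (B + α / A) : ℝ) * μ - (α * 0 / ((A + 0) ^ 2 * (B + α / A) ^ 2) : ℝ) =
      μ * (μ - (1 / (B + α / A) : ℝ)) := by
    push_cast; ring
  rw [this, mul_eq_zero, sub_eq_zero]

theorem isSaddle_axis (hα : 0 < α) (hA : 0 < A) (hB : 0 < B) (h : B + α / A < 1) :
    IsSaddle (systemMap α A B) (α / A, 0) := by
  have h0 : 0 < B + α / A := by positivity
  have hn : 1 < ‖((1 / (B + α / A) : ℝ) : ℂ)‖ := by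
    rw [Complex.norm_real, Real.norm_of_nonneg (by positivity), lt_div_iff₀ h0]; linarith
  refine ⟨systemMap_axis_equilibrium,
    differentiableAt_systemMap (by simpa using hA.ne') h0.ne', ?_, ⟨0, ?_, by simp⟩, ⟨_, ?_, hn⟩⟩
  · intro μ hμ
    rcases (mem_jacobianEigenvalues_axis_iff hA.ne' h0.ne' μ).1 hμ with rfl | rfl
    · simp
    · exact hn.ne'
  · exact (mem_jacobianEigenvalues_axis_iff hA.ne' h0.ne' _).2 (Or.inl rfl)
  · exact (mem_jacobianEigenvalues_axis_iff hA.ne' h0.ne' _).2 (Or.inr rfl)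

theorem isNonhyperbolic_axis (hA : 0 < A) (h : B + α / A = 1) :
    IsNonhyperbolic (systemMap α A B) (α / A, 0) := by
  have h0 : B + α / A ≠ 0 := by rw [h]; exact one_ne_zero
  refine ⟨systemMap_axis_equilibrium, differentiableAt_systemMap (by simpa using hA.ne') h0,
    1, ?_, by simp⟩
  exact (mem_jacobianEigenvalues_axis_iff hA.ne' h0 _).2 (Or.inr (by simp [h]))

/-- At the interior equilibrium the eigenvalues are the roots of `μ² - μ - d` for some
`d ∈ (0, 1)`: one is larger than `1` and the other lies in `(-1, 0)`. -/
theorem isSaddle_interior (hα : 0 < α) (hA : 0 < A) (hB : 0 < B) (h : 1 < B + α / A)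
    (hB' : B < 1) : IsSaddle (systemMap α A B) (1 - B, α / (1 - B) - A) := by
  have hy := interior_equilibrium_pos hA h hB'
  have h1 : 0 < 1 - B := by linarith
  have hAy : A + (α / (1 - B) - A) = α / (1 - B) := by ring
  have hAy0 : A + (α / (1 - B) - A) ≠ 0 := by rw [hAy]; positivity
  have hBx : B + (1 - B) = 1 := by ring
  have hBx0 : B + (1 - B) ≠ 0 := by rw [hBx]; exact one_ne_zero
  set d := (1 - B) * ((α / (1 - B) - A) / (α / (1 - B))) with hd
  have hd0 : 0 < d := by positivity
  have hd1 : d < 1 := by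
    have : (α / (1 - B) - A) / (α / (1 - B)) < 1 := by
      rw [div_lt_one (by positivity)]; linarith
    nlinarith
  set s := Real.sqrt (1 + 4 * d) with hs
  have hs2 : s ^ 2 = 1 + 4 * d := Real.sq_sqrt (by positivity)
  have hs0 : 0 ≤ s := Real.sqrt_nonneg _
  have hs1 : 1 < s := by nlinarith
  have hs3 : s < 3 := by nlinarith
  have key : ∀ μ : ℂ, μ ∈ jacobianEigenvalues (systemMap α A B) (1 - B, α / (1 - B) - A) ↔
      μ = ((1 + s) / 2 : ℝ) ∨ μ = ((1 - s) / 2 : ℝ) := by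
    intro μ
    rw [mem_jacobianEigenvalues_iff hAy0 hBx0]
    have e : α * (α / (1 - B) - A) / ((A + (α / (1 - B) - A)) ^ 2 * (B + (1 - B)) ^ 2) =
        (s ^ 2 - 1) / 4 := by
      rw [hs2, hAy, hBx, hd]; field_simp; ring
    rw [e, hBx]
    have : μ ^ 2 - (1 / 1 : ℝ) * μ - ((s ^ 2 - 1) / 4 : ℝ) =
        (μ - ((1 + s) / 2 : ℝ)) * (μ - ((1 - s) / 2 : ℝ)) := by
      push_cast; ring
    rw [this, mul_eq_zero, sub_eq_zero, sub_eq_zero]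
  have hu : 1 < ‖(((1 + s) / 2 : ℝ) : ℂ)‖ := by
    rw [Complex.norm_real, Real.norm_eq_abs, lt_abs]; left; linarith
  have hl : ‖(((1 - s) / 2 : ℝ) : ℂ)‖ < 1 := by
    rw [Complex.norm_real, Real.norm_eq_abs, abs_lt]; constructor <;> linarith
  refine ⟨systemMap_interior_equilibrium hα hB', differentiableAt_systemMap hAy0 hBx0, ?_,
    ⟨_, (key _).2 (Or.inr rfl), hl⟩, ⟨_, (key _).2 (Or.inl rfl), hu⟩⟩
  intro μ hμ
  rcases (key μ).1 hμ with rfl | rfl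
  · exact hu.ne'
  · exact hl.ne

end Jacobian

/-! ### Trichotomy for interior orbits -/

section Trichotomy

variable {α A B : ℝ}

theorem add_div_interior_equilibrium (hα : 0 < α) (hB' : B < 1) :
    B + α / (A + (α / (1 - B) - A)) = 1 := by
  have : 1 - B ≠ 0 := by linarith
  rw [add_sub_cancel]
  field_simp
  ring

theorem tendsToZeroInfinity_of_lt (hα : 0 < α) (hA : 0 < A) (hB : 0 < B) (h : 1 < B + α / A)
    (hB' : B < 1) {p : ℝ × ℝ} (hp : p ∈ closedQuadrant) (n : ℕ)
    (h0 : α / (1 - B) - A < ((systemMap α A B)^[n] p).2)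
    (h1 : α / (1 - B) - A < ((systemMap α A B)^[n + 1] p).2) :
    TendsToZeroInfinity (systemMap α A B) p := by
  have hy := interior_equilibrium_pos hA h hB'
  have hm := lt_min h0 h1
  refine tendsToZeroInfinity_of_le hα hA hB (hy.trans hm) ?_ hp n (min_le_left _ _)
    (min_le_right _ _)
  have h2 : α / (A + min ((systemMap α A B)^[n] p).2 ((systemMap α A B)^[n + 1] p).2) <
      α / (A + (α / (1 - B) - A)) := by gcongr
  linarith [add_div_interior_equilibrium (A := A) hα hB']

theorem tendsto_extinction_of_lt (hα : 0 < α) (hA : 0 < A) (hB : 0 < B)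
    (hB' : B < 1) {p : ℝ × ℝ} (hp : p ∈ closedQuadrant) (n : ℕ)
    (h0 : ((systemMap α A B)^[n] p).2 < α / (1 - B) - A)
    (h1 : ((systemMap α A B)^[n + 1] p).2 < α / (1 - B) - A) :
    Tendsto (fun n : ℕ => (systemMap α A B)^[n] p) atTop (𝓝 (α / A, 0)) := by
  have hm := max_lt h0 h1
  have h3 := (iterate_mem_closedQuadrant hα hA hB hp n).2.trans (le_max_left _
    ((systemMap α A B)^[n + 1] p).2)
  refine tendsto_extinction_of_le hα hA hB ?_ hp n (le_max_left _ _) (le_max_right _ _)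
  have h2 : α / (A + (α / (1 - B) - A)) <
      α / (A + max ((systemMap α A B)^[n] p).2 ((systemMap α A B)^[n + 1] p).2) := by gcongr
  linarith [add_div_interior_equilibrium (A := A) hα hB']

/-- With `e` the interior equilibrium value, `y (B + α / (A + y))` is increasing in `y` and equals
`e` at `e`, whereas `B + α / (A + y)` is decreasing and equals `1` at `e`. Hence the logarithm of
the growth rate is dominated by the logarithmic distance to the equilibrium. -/
theorem abs_log_growth_le (hα : 0 < α) (hA : 0 < A) (hB : 0 < B) {e y : ℝ} (he : 0 < e)
    (hy : 0 < y) (h : B + α / (A + e) = 1) :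
    |Real.log (B + α / (A + y))| ≤ |Real.log (y / e)| := by
  have hf : 0 < B + α / (A + y) := by positivity
  have mono : ∀ {u v : ℝ}, 0 < u → u ≤ v → u * (B + α / (A + u)) ≤ v * (B + α / (A + v)) := by
    intro u v hu huv
    have h1 : ∀ {w : ℝ}, 0 < w → w * (B + α / (A + w)) = w * B + α - α * A / (A + w) := by
      intro w hw; field_simp; ring
    rw [h1 hu, h1 (hu.trans_le huv)]
    have : α * A / (A + v) ≤ α * A / (A + u) := by gcongr
    nlinarith
  rcases le_total y e with hye | hey
  · have h1 : 1 ≤ B + α / (A + y) := by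
      rw [← h]; gcongr
    have h2 := mono hy hye
    rw [h, mul_one] at h2
    rw [abs_of_nonneg (Real.log_nonneg h1), ← abs_neg, ← Real.log_inv, inv_div]
    refine le_trans (Real.log_le_log hf ?_) (le_abs_self _)
    rw [le_div_iff₀ hy]; linarith
  · have h1 : B + α / (A + y) ≤ 1 := by
      rw [← h]; gcongr
    have h2 := mono he hey
    rw [h, mul_one] at h2
    rw [← abs_neg, ← Real.log_inv]
    have h3 : 1 ≤ (B + α / (A + y))⁻¹ := (one_le_inv₀ hf).2 h1
    rw [abs_of_nonneg (Real.log_nonneg h3)]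
    refine le_trans (Real.log_le_log (by positivity) ?_) (le_abs_self _)
    rw [inv_le_comm₀ hf (by positivity), inv_div, div_le_iff₀ hy]
    linarith

/-- A nonnegative sequence with `a (n + 2) + a (n + 1) ≤ a n` is summable by telescoping. -/
theorem tendsto_zero_of_add_le {a : ℕ → ℝ} (h0 : ∀ n, 0 ≤ a n)
    (h : ∀ n, a (n + 2) + a (n + 1) ≤ a n) : Tendsto a atTop (𝓝 0) := by
  rw [← tendsto_add_atTop_iff_nat 1]
  refine (summable_of_sum_range_le (c := a 0 + a 1) (fun n => h0 _) fun n => ?_).tendsto_atTop_zero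
  have : ∑ i ∈ Finset.range n, a (i + 1) ≤ a 0 + a 1 - a n - a (n + 1) := by
    induction n with
    | zero => simp
    | succ n ih => rw [Finset.sum_range_succ]; linarith [h n]
  linarith [h0 n, h0 (n + 1)]

/-- An orbit that never has two consecutive second coordinates strictly on the same side of the
equilibrium value converges to the interior equilibrium: consecutive logarithmic deviations have
opposite signs, so their absolute values add up. -/
theorem tendsto_interior_of_alternating (hα : 0 < α) (hA : 0 < A) (hB : 0 < B)
    (h : 1 < B + α / A) (hB' : B < 1) {p : ℝ × ℝ} (hp : p ∈ openQuadrant)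
    (h1 : ∀ n, ¬ (α / (1 - B) - A < ((systemMap α A B)^[n] p).2 ∧
      α / (1 - B) - A < ((systemMap α A B)^[n + 1] p).2))
    (h2 : ∀ n, ¬ (((systemMap α A B)^[n] p).2 < α / (1 - B) - A ∧
      ((systemMap α A B)^[n + 1] p).2 < α / (1 - B) - A)) :
    Tendsto (fun n : ℕ => (systemMap α A B)^[n] p) atTop (𝓝 (1 - B, α / (1 - B) - A)) := by
  have hy := interior_equilibrium_pos hA h hB'
  have hf := add_div_interior_equilibrium (A := A) hα hB'
  have hx : α / (A + (α / (1 - B) - A)) = 1 - B := by linarith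
  have hpos := fun n => (iterate_mem_openQuadrant hα hA hB hp n).2
  suffices hs : Tendsto (fun n : ℕ => ((systemMap α A B)^[n] p).2) atTop
      (𝓝 (α / (1 - B) - A)) by
    have := tendsto_iterate_of_tendsto_snd (by positivity) hs
    rwa [hx] at this
  generalize α / (1 - B) - A = e at *
  set Y : ℕ → ℝ := fun n => Real.log (((systemMap α A B)^[n] p).2 / e) with hY
  have hYpos : ∀ n, 0 < Y n ↔ e < ((systemMap α A B)^[n] p).2 := fun n => by
    rw [hY, Real.log_pos_iff (by have := hpos n; positivity), one_lt_div hy]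
  have hYneg : ∀ n, Y n < 0 ↔ ((systemMap α A B)^[n] p).2 < e := fun n => by
    have := hpos n
    rw [hY, Real.log_neg_iff (by positivity), div_lt_one hy]
  have hrec : ∀ n, |Y (n + 2) - Y (n + 1)| ≤ |Y n| := fun n => by
    have h3 := hpos n
    have h4 := hpos (n + 1)
    have h5 : 0 < B + α / (A + ((systemMap α A B)^[n] p).2) := by positivity
    have h6 : Y (n + 2) - Y (n + 1) = -Real.log (B + α / (A + ((systemMap α A B)^[n] p).2)) := by
      simp only [hY]
      rw [iterate_add_two_snd, div_right_comm, Real.log_div (by positivity) h5.ne']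
      ring
    rw [h6, abs_neg]
    exact abs_log_growth_le hα hA hB hy h3 hf
  have hlim : Tendsto (fun n => |Y n|) atTop (𝓝 0) := by
    refine tendsto_zero_of_add_le (fun n => abs_nonneg _) fun n => ?_
    refine le_trans (le_of_eq ?_) (hrec n)
    have h3 := h1 (n + 1)
    have h4 := h2 (n + 1)
    rw [← hYpos, ← hYpos] at h3
    rw [← hYneg, ← hYneg] at h4
    rcases le_or_gt (Y (n + 2)) 0 with h5 | h5
    · have h6 : 0 ≤ Y (n + 1) ∨ Y (n + 2) = 0 := by
        by_contra! h7
        exact h4 ⟨h7.1, h5.lt_of_ne h7.2⟩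
      rcases h6 with h6 | h6
      · rw [abs_of_nonpos h5, abs_of_nonneg h6, abs_of_nonpos (by linarith)]; ring
      · simp [h6]
    · have h6 : Y (n + 1) ≤ 0 := by
        by_contra! h7
        exact h3 ⟨h7, h5⟩
      rw [abs_of_pos h5, abs_of_nonpos h6, abs_of_nonneg (by linarith)]; ring
  have hY0 : Tendsto Y atTop (𝓝 0) := by
    rwa [tendsto_zero_iff_abs_tendsto_zero]
  have h3 := ((Real.continuous_exp.tendsto 0).comp hY0).mul_const e
  rw [Real.exp_zero, one_mul] at h3
  refine h3.congr fun n => ?_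
  have := hpos n
  simp only [Function.comp, hY]
  rw [Real.exp_log (by positivity), div_mul_cancel₀ _ hy.ne']

/-- The possible fates of an orbit in the open quadrant. -/
theorem trichotomy (hα : 0 < α) (hA : 0 < A) (hB : 0 < B)
    (h : 1 < B + α / A) (hB' : B < 1) {p : ℝ × ℝ} (hp : p ∈ openQuadrant) :
    TendsToZeroInfinity (systemMap α A B) p ∨
    Tendsto (fun n : ℕ => (systemMap α A B)^[n] p) atTop (𝓝 (α / A, 0)) ∨
    Tendsto (fun n : ℕ => (systemMap α A B)^[n] p) atTop (𝓝 (1 - B, α / (1 - B) - A)) := by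
  have hp' := openQuadrant_subset_closedQuadrant hp
  by_contra! hcon
  refine hcon.2.2 (tendsto_interior_of_alternating hα hA hB h hB' hp (fun n hn => ?_)
    fun n hn => ?_)
  · exact hcon.1 (tendsToZeroInfinity_of_lt hα hA hB h hB' hp' n hn.1 hn.2)
  · exact hcon.2.1 (tendsto_extinction_of_lt hα hA hB hB' hp' n hn.1 hn.2)

theorem tendsto_interior_of_bounds (hα : 0 < α) (hA : 0 < A) (hB : 0 < B)
    (h : 1 < B + α / A) (hB' : B < 1) {p : ℝ × ℝ} (hp : p ∈ openQuadrant) {m M : ℝ} (hm : 0 < m)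
    (h1 : ∀ n, m ≤ ((systemMap α A B)^[n] p).2) (h2 : ∀ n, ((systemMap α A B)^[n] p).2 ≤ M) :
    Tendsto (fun n : ℕ => (systemMap α A B)^[n] p) atTop (𝓝 (1 - B, α / (1 - B) - A)) := by
  rcases trichotomy hα hA hB h hB' hp with h3 | h3 | h3
  · obtain ⟨n, hn⟩ := (h3.2.eventually_gt_atTop M).exists
    exact absurd (h2 n) (not_le.2 hn)
  · have := ge_of_tendsto' ((continuous_snd.tendsto _).comp h3) h1
    exact absurd this (not_le.2 hm)
  · exact h3

end Trichotomy

/-! ### Competitive comparison and the separating curve -/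

section Separatrix

variable {α A B : ℝ}

/-- The map is competitive: decreasing the first coordinate and multiplying the second one by at
least `c ≥ 1` is preserved along orbits. -/
theorem comparison (hα : 0 < α) (hA : 0 < A) (hB : 0 < B) {p q : ℝ × ℝ}
    (hp : p ∈ closedQuadrant) (hq : q ∈ closedQuadrant) {c : ℝ} (hc : 1 ≤ c)
    (h1 : q.1 ≤ p.1) (h2 : c * p.2 ≤ q.2) (n : ℕ) :
    ((systemMap α A B)^[n] q).1 ≤ ((systemMap α A B)^[n] p).1 ∧
      c * ((systemMap α A B)^[n] p).2 ≤ ((systemMap α A B)^[n] q).2 := by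
  induction n with
  | zero => exact ⟨h1, h2⟩
  | succ n ih =>
    have hpn := iterate_mem_closedQuadrant hα hA hB hp n
    have hqn := iterate_mem_closedQuadrant hα hA hB hq n
    simp only [iterate_succ_fst, iterate_succ_snd]
    generalize (systemMap α A B)^[n] p = u at *
    generalize (systemMap α A B)^[n] q = v at *
    obtain ⟨ih1, ih2⟩ := ih
    obtain ⟨hu1, hu2⟩ := hpn
    obtain ⟨hv1, hv2⟩ := hqn
    have h3 : u.2 ≤ v.2 := (le_mul_of_one_le_left hu2 hc).trans ih2
    refine ⟨by gcongr, ?_⟩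
    rw [← mul_div_assoc]
    gcongr

/-- The interior equilibrium attracts at most one of two orbits whose second coordinates start out
in a ratio `c > 1` compatible with the order. -/
theorem not_tendsto_interior_both (hα : 0 < α) (hA : 0 < A) (hB : 0 < B)
    (h : 1 < B + α / A) (hB' : B < 1) {p q : ℝ × ℝ}
    (hp : p ∈ closedQuadrant) (hq : q ∈ closedQuadrant) {c : ℝ} (hc : 1 < c)
    (h1 : q.1 ≤ p.1) (h2 : c * p.2 ≤ q.2)
    (hpt : Tendsto (fun n : ℕ => (systemMap α A B)^[n] p) atTop (𝓝 (1 - B, α / (1 - B) - A)))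
    (hqt : Tendsto (fun n : ℕ => (systemMap α A B)^[n] q) atTop (𝓝 (1 - B, α / (1 - B) - A))) :
    False := by
  have hy := interior_equilibrium_pos hA h hB'
  have h3 := le_of_tendsto_of_tendsto' (((continuous_snd.tendsto _).comp hpt).const_mul c)
    ((continuous_snd.tendsto _).comp hqt)
    (fun n => (comparison hα hA hB hp hq hc.le h1 h2 n).2)
  dsimp only at h3
  nlinarith

/-- On every vertical half-line, escape and extinction are nonempty open conditions, so by
connectedness some orbit does neither. -/
theorem exists_tendsto_interior (hα : 0 < α) (hA : 0 < A) (hB : 0 < B)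
    (h : 1 < B + α / A) (hB' : B < 1) {x : ℝ} (hx : 0 < x) :
    ∃ y, 0 < y ∧ Tendsto (fun n : ℕ => (systemMap α A B)^[n] (x, y)) atTop
      (𝓝 (1 - B, α / (1 - B) - A)) := by
  have he := interior_equilibrium_pos hA h hB'
  by_contra! hcon
  set e := α / (1 - B) - A with hedef
  have hcont : ∀ n, ContinuousOn (fun y => ((systemMap α A B)^[n] (x, y)).2) (Ioi 0) := by
    intro n y hy
    have h1 : ContinuousAt (systemMap α A B)^[n] (x, y) :=
      continuousAt_iterate hα hA hB ⟨hx.le, (mem_Ioi.1 hy).le⟩ n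
    have h2 : ContinuousAt (fun y : ℝ => (x, y)) y := by fun_prop
    have h3 : ContinuousAt (fun y => (systemMap α A B)^[n] (x, y)) y := h1.comp h2
    exact h3.snd.continuousWithinAt
  set U : Set ℝ := ⋃ n, Ioi 0 ∩ (fun y => (((systemMap α A B)^[n] (x, y)).2,
    ((systemMap α A B)^[n + 1] (x, y)).2)) ⁻¹' (Ioi e ×ˢ Ioi e) with hU
  set V : Set ℝ := ⋃ n, Ioi 0 ∩ (fun y => (((systemMap α A B)^[n] (x, y)).2,
    ((systemMap α A B)^[n + 1] (x, y)).2)) ⁻¹' (Iio e ×ˢ Iio e) with hV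
  have hUo : IsOpen U := isOpen_iUnion fun n =>
    ((hcont n).prodMk (hcont (n + 1))).isOpen_inter_preimage isOpen_Ioi (isOpen_Ioi.prod isOpen_Ioi)
  have hVo : IsOpen V := isOpen_iUnion fun n =>
    ((hcont n).prodMk (hcont (n + 1))).isOpen_inter_preimage isOpen_Ioi (isOpen_Iio.prod isOpen_Iio)
  have hB2 : 0 < B + x := by positivity
  have hUne : (Ioi 0 ∩ U).Nonempty := by
    refine ⟨max e (e * (B + x)) + (1 + (B + x)), ?_, ?_⟩
    · have := le_max_left e (e * (B + x))
      simp only [mem_Ioi]; linarith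
    · refine mem_iUnion.2 ⟨0, ?_, ?_, ?_⟩
      · have := le_max_left e (e * (B + x))
        simp only [mem_Ioi]; linarith
      · have := le_max_left e (e * (B + x))
        simp only [Function.iterate_zero, id, mem_Ioi]; linarith
      · have := le_max_right e (e * (B + x))
        simp only [zero_add, Function.iterate_one, systemMap, mem_Ioi]
        rw [lt_div_iff₀ hB2]; linarith
  have hVne : (Ioi 0 ∩ V).Nonempty := by
    have h0 : 0 < min e (e * (B + x)) := by positivity
    refine ⟨min e (e * (B + x)) / 2, half_pos h0, ?_⟩
    refine mem_iUnion.2 ⟨0, half_pos h0, ?_, ?_⟩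
    · have := min_le_left e (e * (B + x))
      simp only [Function.iterate_zero, id, mem_Iio]; linarith
    · have := min_le_right e (e * (B + x))
      simp only [zero_add, Function.iterate_one, systemMap, mem_Iio]
      rw [div_lt_iff₀ hB2]; linarith
  have hcover : Ioi 0 ⊆ U ∪ V := by
    intro y hy
    by_contra hy'
    refine hcon y hy (tendsto_interior_of_alternating hα hA hB h hB' ⟨hx, hy⟩ (fun n hn => ?_)
      fun n hn => ?_)
    · exact hy' (Or.inl (mem_iUnion.2 ⟨n, hy, hn⟩))
    · exact hy' (Or.inr (mem_iUnion.2 ⟨n, hy, hn⟩))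
  obtain ⟨y, hy, hyU, hyV⟩ := isPreconnected_Ioi U V hUo hVo hcover hUne hVne
  obtain ⟨n, -, hn1, hn2⟩ := mem_iUnion.1 hyU
  obtain ⟨k, -, hk1, hk2⟩ := mem_iUnion.1 hyV
  have hp : (x, y) ∈ closedQuadrant := ⟨hx.le, (mem_Ioi.1 hy).le⟩
  exact (tendsToZeroInfinity_of_lt hα hA hB h hB' hp n hn1 hn2).not_tendsto
    (tendsto_extinction_of_lt hα hA hB hB' hp k hk1 hk2)

/-- `C` is the curve whose graph over `(0, ∞)` consists of points attracted by the interior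
equilibrium. -/
structure IsSeparatrixFunction (α A B : ℝ) (C : ℝ → ℝ) : Prop where
  pos : ∀ x, 0 < x → 0 < C x
  tendsto : ∀ x, 0 < x → Tendsto (fun n : ℕ => (systemMap α A B)^[n] (x, C x)) atTop
      (𝓝 (1 - B, α / (1 - B) - A))

theorem exists_isSeparatrixFunction (hα : 0 < α) (hA : 0 < A) (hB : 0 < B)
    (h : 1 < B + α / A) (hB' : B < 1) : ∃ C, IsSeparatrixFunction α A B C := by
  choose! C hC using fun x (hx : 0 < x) => exists_tendsto_interior hα hA hB h hB' hx
  exact ⟨C, fun x hx => (hC x hx).1, fun x hx => (hC x hx).2⟩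

variable {C : ℝ → ℝ}

theorem IsSeparatrixFunction.tendsToZeroInfinity (hC : IsSeparatrixFunction α A B C)
    (hα : 0 < α) (hA : 0 < A) (hB : 0 < B) (h : 1 < B + α / A) (hB' : B < 1) {x y : ℝ}
    (hx : 0 < x) (hy : C x < y) : TendsToZeroInfinity (systemMap α A B) (x, y) := by
  have hCx := hC.pos x hx
  have hp : (x, C x) ∈ closedQuadrant := ⟨hx.le, hCx.le⟩
  have hq : (x, y) ∈ openQuadrant := ⟨hx, hCx.trans hy⟩
  have hq' := openQuadrant_subset_closedQuadrant hq
  have hc : 1 < y / C x := by rwa [one_lt_div hCx]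
  have h2 : y / C x * C x ≤ y := (div_mul_cancel₀ _ hCx.ne').le
  rcases trichotomy hα hA hB h hB' hq with h3 | h3 | h3
  · exact h3
  · have h4 := le_of_tendsto_of_tendsto' ((continuous_snd.tendsto _).comp (hC.tendsto x hx))
      ((continuous_snd.tendsto _).comp h3)
      (fun n => (by simpa using (comparison hα hA hB hp hq' le_rfl le_rfl (by simpa using hy.le) n).2))
    exact absurd h4 (not_le.2 (interior_equilibrium_pos hA h hB'))
  · exact (not_tendsto_interior_both hα hA hB h hB' hp hq' hc le_rfl h2 (hC.tendsto x hx) h3).elim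

theorem IsSeparatrixFunction.tendsto_extinction (hC : IsSeparatrixFunction α A B C)
    (hα : 0 < α) (hA : 0 < A) (hB : 0 < B) (h : 1 < B + α / A) (hB' : B < 1) {x y : ℝ}
    (hx : 0 < x) (hy0 : 0 ≤ y) (hy : y < C x) :
    Tendsto (fun n : ℕ => (systemMap α A B)^[n] (x, y)) atTop (𝓝 (α / A, 0)) := by
  rcases hy0.eq_or_lt with rfl | hy0
  · exact tendsto_of_snd_eq_zero hA rfl
  have hCx := hC.pos x hx
  have hq : (x, C x) ∈ closedQuadrant := ⟨hx.le, hCx.le⟩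
  have hp : (x, y) ∈ openQuadrant := ⟨hx, hy0⟩
  have hp' := openQuadrant_subset_closedQuadrant hp
  have hc : 1 < C x / y := by rwa [one_lt_div hy0]
  have h2 : C x / y * y ≤ C x := (div_mul_cancel₀ _ hy0.ne').le
  rcases trichotomy hα hA hB h hB' hp with h3 | h3 | h3
  · refine absurd ((continuous_snd.tendsto _).comp (hC.tendsto x hx))
      (not_tendsto_nhds_of_tendsto_atTop (tendsto_atTop_mono (fun n => ?_) h3.2) _)
    simpa using (comparison hα hA hB hp' hq le_rfl le_rfl (by simpa using hy.le) n).2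
  · exact h3
  · exact (not_tendsto_interior_both hα hA hB h hB' hp' hq hc le_rfl h2 h3 (hC.tendsto x hx)).elim

theorem IsSeparatrixFunction.tendsto_interior_iff (hC : IsSeparatrixFunction α A B C)
    (hα : 0 < α) (hA : 0 < A) (hB : 0 < B) (h : 1 < B + α / A) (hB' : B < 1) {x y : ℝ}
    (hx : 0 < x) (hy : 0 < y) :
    Tendsto (fun n : ℕ => (systemMap α A B)^[n] (x, y)) atTop (𝓝 (1 - B, α / (1 - B) - A)) ↔
      y = C x := by
  refine ⟨fun ht => ?_, fun he => he ▸ hC.tendsto x hx⟩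
  rcases lt_trichotomy y (C x) with h1 | h1 | h1
  · have := tendsto_nhds_unique ht (hC.tendsto_extinction hα hA hB h hB' hx hy.le h1)
    exact absurd (congrArg Prod.snd this) (interior_equilibrium_pos hA h hB').ne'
  · exact h1
  · exact ((hC.tendsToZeroInfinity hα hA hB h hB' hx h1).not_tendsto ht).elim

/-- If `x < x'` but `C x' ≤ C x`, then after one step the second coordinates of the two orbits are in
a ratio of at least `(B + x') / (B + x) > 1`. -/
theorem IsSeparatrixFunction.strictMonoOn (hC : IsSeparatrixFunction α A B C)
    (hα : 0 < α) (hA : 0 < A) (hB : 0 < B) (h : 1 < B + α / A) (hB' : B < 1) :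
    StrictMonoOn C (Ioi 0) := by
  intro x hx x' hx' hlt
  rw [mem_Ioi] at hx hx'
  by_contra! hle
  have hC' := hC.pos x' hx'
  have hp : (x', C x') ∈ closedQuadrant := ⟨hx'.le, hC'.le⟩
  have hq : (x, C x) ∈ closedQuadrant := ⟨hx.le, (hC.pos x hx).le⟩
  have h1 : 1 < (B + x') / (B + x) := by rw [one_lt_div (by positivity)]; linarith
  refine not_tendsto_interior_both hα hA hB h hB' (p := systemMap α A B (x', C x'))
    (q := systemMap α A B (x, C x)) (systemMap_mem_closedQuadrant hα hA hB hp)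
    (systemMap_mem_closedQuadrant hα hA hB hq) h1 ?_ ?_
    ((tendsto_iterate_shift 1).2 (hC.tendsto x' hx'))
    ((tendsto_iterate_shift 1).2 (hC.tendsto x hx))
  · simp only [systemMap]; gcongr
  · simp only [systemMap]
    calc (B + x') / (B + x) * (C x' / (B + x')) = C x' / (B + x) := by field_simp
      _ ≤ _ := by gcongr

end Separatrix

/-! ### Bounded solutions of the linearized recurrence -/

section LinearRecurrence

/-- Two consecutive terms above `H / δ` stay above it and grow at least linearly. -/
theorem tendsto_atTop_of_recurrence {δ H K : ℝ} {d h η : ℕ → ℝ} (hδ : 0 < δ)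
    (hd : ∀ n, δ ≤ d n) (hh : ∀ n, |h n| ≤ H) (hK : H + 1 ≤ δ * K)
    (hrec : ∀ n, η (n + 2) = η (n + 1) + d n * η n + h n) (k : ℕ) (h0 : K ≤ η k)
    (h1 : K ≤ η (k + 1)) : Tendsto η atTop atTop := by
  have hH : 0 ≤ H := (abs_nonneg _).trans (hh 0)
  have hK0 : 0 < K := by
    by_contra! hneg
    nlinarith
  have key : ∀ j : ℕ, K ≤ η (j + k) ∧ K + j ≤ η (j + (k + 1)) := by
    intro j
    induction j with
    | zero => exact ⟨by simpa using h0, by simpa using h1⟩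
    | succ j ih =>
      obtain ⟨ih1, ih2⟩ := ih
      have hj : (0 : ℝ) ≤ j := j.cast_nonneg
      have e1 : j + 1 + k = j + (k + 1) := by ring
      have e2 : j + 1 + (k + 1) = j + k + 2 := by ring
      refine ⟨by rw [e1]; linarith, ?_⟩
      rw [e2, hrec]
      have h3 := (abs_le.1 (hh (j + k))).1
      have h4 : δ * K ≤ d (j + k) * η (j + k) :=
        mul_le_mul (hd _) ih1 hK0.le (hδ.le.trans (hd _))
      have e3 : j + (k + 1) = j + k + 1 := by ring
      rw [e3] at ih2
      push_cast
      linarith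
  rw [← tendsto_add_atTop_iff_nat (k + 1)]
  exact tendsto_atTop_mono (fun j => (key j).2)
    (tendsto_atTop_add_const_left _ K tendsto_natCast_atTop_atTop)

/-- The solution of `η (n + 2) = η (n + 1) + d n * η n + h n` with `η 0 = a`, `η 1 = s`. -/
noncomputable def shootingSolution (d h : ℕ → ℝ) (a s : ℝ) : ℕ → ℝ
  | 0 => a
  | 1 => s
  | n + 2 => shootingSolution d h a s (n + 1) + d n * shootingSolution d h a s n + h n

theorem continuous_shootingSolution (d h : ℕ → ℝ) (a : ℝ) (n : ℕ) :
    Continuous fun s => shootingSolution d h a s n := by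
  induction n using Nat.twoStepInduction with
  | zero => exact continuous_const
  | one => exact continuous_id
  | more n ih1 ih2 =>
    simp only [shootingSolution]
    fun_prop

/-- Shooting: the values of `η 1` for which the solution tends to `+∞`, respectively `-∞`, form
disjoint nonempty open sets, so some value gives neither; such a solution is bounded because
`d n ≤ D < 1`. -/
theorem exists_bounded_solution {δ D H : ℝ} {d h : ℕ → ℝ} (hδ : 0 < δ) (hD : D < 1)
    (hd : ∀ n, δ ≤ d n) (hd' : ∀ n, d n ≤ D) (hh : ∀ n, |h n| ≤ H) (a : ℝ) :
    ∃ η : ℕ → ℝ, η 0 = a ∧ (∀ n, η (n + 2) = η (n + 1) + d n * η n + h n) ∧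
      ∃ M, ∀ n, |η n| ≤ M := by
  have hH : 0 ≤ H := (abs_nonneg _).trans (hh 0)
  have hD0 : 0 < D := hδ.trans_le ((hd 0).trans (hd' 0))
  set K := (H + 1) / δ with hKdef
  have hK0 : 0 < K := by positivity
  have hK : H + 1 ≤ δ * K := by rw [hKdef]; field_simp; exact le_rfl
  have hrec : ∀ s n, shootingSolution d h a s (n + 2) =
      shootingSolution d h a s (n + 1) + d n * shootingSolution d h a s n + h n := fun s n => rfl
  have hup : ∀ s k, K < shootingSolution d h a s k → K < shootingSolution d h a s (k + 1) →
      Tendsto (shootingSolution d h a s) atTop atTop := fun s k h0 h1 =>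
    tendsto_atTop_of_recurrence hδ hd hh hK (hrec s) k h0.le h1.le
  have hlow : ∀ s k, shootingSolution d h a s k < -K → shootingSolution d h a s (k + 1) < -K →
      Tendsto (shootingSolution d h a s) atTop atBot := fun s k h0 h1 => by
    have := tendsto_atTop_of_recurrence (η := fun n => -shootingSolution d h a s n)
      (h := fun n => -h n) hδ hd (fun n => by rw [abs_neg]; exact hh n) hK
      (fun n => by rw [hrec]; ring) k (by linarith) (by linarith)
    exact tendsto_neg_atTop_iff.1 this
  set U : Set ℝ := ⋃ n, {s | K < shootingSolution d h a s n} ∩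
    {s | K < shootingSolution d h a s (n + 1)}
  set V : Set ℝ := ⋃ n, {s | shootingSolution d h a s n < -K} ∩
    {s | shootingSolution d h a s (n + 1) < -K}
  have hcont := continuous_shootingSolution d h a
  have hUo : IsOpen U := isOpen_iUnion fun n =>
    (isOpen_lt continuous_const (hcont n)).inter (isOpen_lt continuous_const (hcont (n + 1)))
  have hVo : IsOpen V := isOpen_iUnion fun n =>
    (isOpen_lt (hcont n) continuous_const).inter (isOpen_lt (hcont (n + 1)) continuous_const)
  have hc : 0 ≤ |d 0 * a + h 0| := abs_nonneg _
  have hUne : (univ ∩ U).Nonempty := by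
    refine ⟨K + 1 + |d 0 * a + h 0|, mem_univ _, mem_iUnion.2 ⟨1, ?_, ?_⟩⟩
    · change K < K + 1 + |d 0 * a + h 0|
      linarith
    · change K < K + 1 + |d 0 * a + h 0| + d 0 * a + h 0
      linarith [neg_abs_le (d 0 * a + h 0)]
  have hVne : (univ ∩ V).Nonempty := by
    refine ⟨-(K + 1 + |d 0 * a + h 0|), mem_univ _, mem_iUnion.2 ⟨1, ?_, ?_⟩⟩
    · change -(K + 1 + |d 0 * a + h 0|) < -K
      linarith
    · change -(K + 1 + |d 0 * a + h 0|) + d 0 * a + h 0 < -K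
      linarith [le_abs_self (d 0 * a + h 0)]
  obtain ⟨s, hs⟩ : ∃ s, s ∉ U ∪ V := by
    by_contra! hcon
    obtain ⟨s, -, hsU, hsV⟩ :=
      isPreconnected_univ U V hUo hVo (fun s _ => hcon s) hUne hVne
    obtain ⟨n, hn1, hn2⟩ := mem_iUnion.1 hsU
    obtain ⟨k, hk1, hk2⟩ := mem_iUnion.1 hsV
    have h1 := (hup s n hn1 hn2).eventually_gt_atTop 0
    have h2 := (hlow s k hk1 hk2).eventually_lt_atBot 0
    obtain ⟨j, hj1, hj2⟩ := (h1.and h2).exists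
    exact lt_asymm hj1 hj2
  refine ⟨shootingSolution d h a s, rfl, hrec s, ?_⟩
  set η := shootingSolution d h a s
  have hnU : ∀ n, ¬ (K < η n ∧ K < η (n + 1)) := fun n hn =>
    hs (Or.inl (mem_iUnion.2 ⟨n, hn⟩))
  have hnV : ∀ n, ¬ (η n < -K ∧ η (n + 1) < -K) := fun n hn =>
    hs (Or.inr (mem_iUnion.2 ⟨n, hn⟩))
  -- consecutive terms are never both above `K` nor both below `-K`, so `η (n + 1)` contributes at
  -- most `K` to the size of `η (n + 2)`
  have step : ∀ n, |η (n + 2)| ≤ D * |η n| + (H + K) := by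
    intro n
    have h1 : |d n * η n + h n| ≤ D * |η n| + H := by
      refine (abs_add_le _ _).trans (add_le_add ?_ (hh n))
      rw [abs_mul, abs_of_pos (hδ.trans_le (hd n))]
      gcongr
      exact hd' n
    have h2 := abs_le.1 h1
    have h3 := hrec s n
    have h4 := hnU (n + 1)
    have h5 := hnV (n + 1)
    have h6 : 0 ≤ D * |η n| := by positivity
    change η (n + 2) = η (n + 1) + d n * η n + h n at h3
    rw [abs_le]
    constructor
    · by_contra! h7
      refine h5 ⟨?_, ?_⟩
      · linarith [h2.1]
      · change η (n + 2) < -K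
        linarith
    · by_contra! h7
      refine h4 ⟨?_, ?_⟩
      · linarith [h2.2]
      · change K < η (n + 2)
        linarith
  refine ⟨max (max |η 0| |η 1|) ((H + K) / (1 - D)), fun n => ?_⟩
  have hM : D * max (max |η 0| |η 1|) ((H + K) / (1 - D)) + (H + K) ≤
      max (max |η 0| |η 1|) ((H + K) / (1 - D)) := by
    have h1 := le_max_right (max |η 0| |η 1|) ((H + K) / (1 - D))
    rw [div_le_iff₀ (by linarith)] at h1
    linarith
  induction n using Nat.twoStepInduction with
  | zero => exact (le_max_left _ _).trans (le_max_left _ _)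
  | one => exact (le_max_right _ _).trans (le_max_left _ _)
  | more n ih1 _ =>
    refine (step n).trans (le_trans ?_ hM)
    gcongr

theorem eq_zero_of_bounded_solution {δ : ℝ} {d η : ℕ → ℝ} (hδ : 0 < δ) (hd : ∀ n, δ ≤ d n)
    (h0 : η 0 = 0) (hrec : ∀ n, η (n + 2) = η (n + 1) + d n * η n)
    {M : ℝ} (hM : ∀ n, |η n| ≤ M) : ∀ n, η n = 0 := by
  -- after rescaling, a nonzero `η 1` would put two consecutive terms above the growth threshold
  have h1 : η 1 = 0 := by
    by_contra hne
    set ξ : ℕ → ℝ := fun n => (1 / δ) / η 1 * η n with hξ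
    have hξrec : ∀ n, ξ (n + 2) = ξ (n + 1) + d n * ξ n + 0 := fun n => by
      simp only [hξ, hrec]; ring
    have hξ1 : ξ 1 = 1 / δ := by simp only [hξ]; field_simp
    have hξ2 : ξ 2 = 1 / δ := by rw [hξrec 0, hξ1]; simp [hξ, h0]
    have ht := tendsto_atTop_of_recurrence (H := 0) (K := 1 / δ) (h := fun _ => 0) hδ hd
      (by simp) (by field_simp; simp) hξrec 1 hξ1.ge hξ2.ge
    obtain ⟨n, hn⟩ := (ht.eventually_gt_atTop (|(1 / δ) / η 1| * M)).exists
    have h3 : ξ n ≤ |(1 / δ) / η 1| * M := by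
      refine (le_abs_self _).trans ?_
      simp only [hξ, abs_mul]
      gcongr
      exact hM n
    exact absurd h3 (not_le.2 hn)
  intro n
  induction n using Nat.twoStepInduction with
  | zero => exact h0
  | one => exact h1
  | more n ih1 ih2 => rw [hrec, ih1, ih2]; simp

end LinearRecurrence

/-! ### Smoothness of the separating curve -/

section Smooth

open BoundedContinuousFunction

/-- The left shift on bounded sequences. -/
noncomputable def seqShift : (ℕ →ᵇ ℝ) →L[ℝ] (ℕ →ᵇ ℝ) :=
  compContinuousCLM ℝ ℝ ⟨Nat.succ, continuous_of_discreteTopology⟩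

@[simp]
theorem seqShift_apply (z : ℕ →ᵇ ℝ) (n : ℕ) : seqShift z n = z (n + 1) := rfl

/-- The initial value of a bounded sequence `z`, together with the defect of `z` in the recurrence
`z (n + 2) * (B * (A + z n) + α) = z (n + 1) * (A + z n)` satisfied by the second coordinates of an
orbit. The recurrence is cleared of denominators so that this is a polynomial map. An orbit
starting at `(x₀, y₀)` corresponds to `z 0 = α / x₀ - A` and `z (n + 1) = y n`: prepending a term
turns the first coordinate `x₀ = α / (A + z 0)` into part of the sequence. -/
noncomputable def orbitDefect (α A B : ℝ) (z : ℕ →ᵇ ℝ) : ℝ × (ℕ →ᵇ ℝ) :=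
  (evalCLM ℝ 0 z, seqShift (seqShift z) * (const ℕ B * (const ℕ A + z) + const ℕ α) -
    seqShift z * (const ℕ A + z))

/-- The derivative of `orbitDefect` at `z`. -/
noncomputable def orbitDefectDeriv (α A B : ℝ) (z : ℕ →ᵇ ℝ) :
    (ℕ →ᵇ ℝ) →L[ℝ] ℝ × (ℕ →ᵇ ℝ) :=
  (evalCLM ℝ 0).prod
    ((ContinuousLinearMap.mul ℝ (ℕ →ᵇ ℝ) (const ℕ B * (const ℕ A + z) + const ℕ α)).comp
        (seqShift.comp seqShift) +
      ContinuousLinearMap.mul ℝ (ℕ →ᵇ ℝ) (const ℕ B * seqShift (seqShift z)) -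
      (ContinuousLinearMap.mul ℝ (ℕ →ᵇ ℝ) (const ℕ A + z)).comp seqShift -
      ContinuousLinearMap.mul ℝ (ℕ →ᵇ ℝ) (seqShift z))

variable {α A B : ℝ}

theorem contDiff_orbitDefect : ContDiff ℝ ∞ (orbitDefect α A B) := by
  unfold orbitDefect
  fun_prop

theorem hasFDerivAt_orbitDefect (z : ℕ →ᵇ ℝ) :
    HasFDerivAt (orbitDefect α A B) (orbitDefectDeriv α A B z) z := by
  have h1 : HasFDerivAt (fun z => seqShift (seqShift z)) (seqShift.comp seqShift) z :=
    (seqShift.comp seqShift).hasFDerivAt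
  have h2 : HasFDerivAt (fun z : ℕ →ᵇ ℝ => const ℕ A + z) (ContinuousLinearMap.id ℝ _) z :=
    (hasFDerivAt_id z).const_add _
  have h3 := (h2.const_mul (const ℕ B)).add_const (const ℕ α)
  refine ((evalCLM ℝ (0 : ℕ)).hasFDerivAt.prodMk
    ((h1.mul h3).sub ((seqShift.hasFDerivAt (x := z)).mul h2))).congr_fderiv ?_
  ext ζ n
  · rfl
  · simp [orbitDefectDeriv]
    ring

/-- Division by the weights `w n`, with `w 0 = A + z 0` and `w n = z n` for `n ≥ 1`, normalizes
the linearized recurrence. -/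
theorem linearized_recurrence_iff {P Q z₁ z₂ w e₀ e₁ e₂ g : ℝ} (hP : 0 < P) (hQ : 0 < Q)
    (hz : 0 < z₁) (hPQ : P = B * Q + α) (hrec : z₂ * P = z₁ * Q) :
    P * (z₂ * e₂) + B * z₂ * (w * e₀) - Q * (z₁ * e₁) - z₁ * (w * e₀) = g ↔
      e₂ = e₁ + α * w / (P * Q) * e₀ + g / (Q * z₁) := by
  obtain rfl : z₂ = z₁ * Q / P := by field_simp; exact hrec
  have hα : α = P - B * Q := by linarith
  subst hα
  rw [← sub_eq_zero, ← sub_eq_zero (a := e₂)]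
  have : P * (z₁ * Q / P * e₂) + B * (z₁ * Q / P) * (w * e₀) - Q * (z₁ * e₁) - z₁ * (w * e₀) - g =
      (Q * z₁) * (e₂ - (e₁ + (P - B * Q) * w / (P * Q) * e₀ + g / (Q * z₁))) := by
    field_simp
    ring
  rw [this, mul_eq_zero_iff_left (by positivity)]

theorem bijective_orbitDefectDeriv (hα : 0 < α) (hA : 0 < A) (hB : 0 < B) {z : ℕ →ᵇ ℝ} {m : ℝ}
    (hm : 0 < m) (h0 : m ≤ A + z 0) (h1 : ∀ n, m ≤ z (n + 1))
    (hrec : ∀ n, z (n + 2) * (B * (A + z n) + α) = z (n + 1) * (A + z n)) :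
    Function.Bijective (orbitDefectDeriv α A B z) := by
  set W := A + ‖z‖ with hW
  have hzW : ∀ n, A + z n ≤ W := fun n => by
    linarith [(le_abs_self _).trans (z.norm_coe_le_norm n)]
  set w : ℕ → ℝ := fun n => if n = 0 then A + z 0 else z n with hw
  have hws : ∀ n, w (n + 1) = z (n + 1) := fun n => by simp [hw]
  have hws' : ∀ n, w (n + 2) = z (n + 2) := fun n => hws (n + 1)
  have hwm : ∀ n, m ≤ w n := fun n => by
    cases n with
    | zero => simpa [hw] using h0
    | succ n => rw [hws]; exact h1 n
  have hwQ : ∀ n, w n ≤ A + z n := fun n => by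
    cases n with
    | zero => simp [hw]
    | succ n => rw [hws]; linarith
  have hQm : ∀ n, m ≤ A + z n := fun n => (hwm n).trans (hwQ n)
  have hQ : ∀ n, 0 < A + z n := fun n => hm.trans_le (hQm n)
  have hP : ∀ n, 0 < B * (A + z n) + α := fun n => by have := hQ n; positivity
  have hw0 : ∀ n, 0 < w n := fun n => hm.trans_le (hwm n)
  have hz0 : ∀ n, 0 < z (n + 1) := fun n => hm.trans_le (h1 n)
  have hW0 : 0 < W := (hQ 0).trans_le (hzW 0)
  set d : ℕ → ℝ := fun n => α * w n / ((B * (A + z n) + α) * (A + z n)) with hd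
  have hdδ : ∀ n, α * m / ((B * W + α) * W) ≤ d n := fun n => by
    have h2 := hP n
    have h3 := hQ n
    have h4 := hw0 n
    simp only [hd]
    gcongr
    exacts [hwm n, hzW n, hzW n]
  have hdD : ∀ n, d n ≤ α / (B * m + α) := fun n => by
    have h2 := hP n
    have h3 := hQ n
    calc d n ≤ α * (A + z n) / ((B * (A + z n) + α) * (A + z n)) := by
          simp only [hd]; gcongr; exact hwQ n
      _ = α / (B * (A + z n) + α) := by field_simp
      _ ≤ _ := by gcongr; exact hQm n
  have hδ : 0 < α * m / ((B * W + α) * W) := by positivity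
  have hD : α / (B * m + α) < 1 := by
    rw [div_lt_one (by positivity)]
    have := mul_pos hB hm
    linarith
  have hL : ∀ (ζ : ℕ →ᵇ ℝ) (n : ℕ), (orbitDefectDeriv α A B z ζ).2 n =
      (B * (A + z n) + α) * ζ (n + 2) + B * z (n + 2) * ζ n - (A + z n) * ζ (n + 1) -
        z (n + 1) * ζ n := fun ζ n => rfl
  constructor
  · rw [injective_iff_map_eq_zero]
    intro ζ hζ
    have hζ0 : ζ 0 = 0 := congrArg Prod.fst hζ
    have hη : ∀ n, ζ n / w n = 0 := by
      refine eq_zero_of_bounded_solution hδ hdδ (by simp [hζ0]) (fun n => ?_)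
        (M := ‖ζ‖ / m) fun n => ?_
      · have h2 := (hL ζ n).symm.trans (congrArg (fun q : ℝ × (ℕ →ᵇ ℝ) => q.2 n) hζ)
        have h3 : ∀ n, ζ n = w n * (ζ n / w n) := fun n =>
          (mul_div_cancel₀ _ (hw0 n).ne').symm
        rw [h3 n, h3 (n + 1), h3 (n + 2), hws', hws n,
          linearized_recurrence_iff (hP n) (hQ n) (hz0 n) rfl (hrec n)] at h2
        rw [hws', hws n]
        simpa using h2
      · rw [abs_div, abs_of_pos (hw0 n)]
        gcongr
        exacts [ζ.norm_coe_le_norm n, hwm n]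
    ext n
    simpa [(hw0 n).ne'] using hη n
  · rintro ⟨a, g⟩
    obtain ⟨η, hη0, hη, M, hM⟩ := exists_bounded_solution (h := fun n => g n / ((A + z n) * z (n + 1)))
      (H := ‖g‖ / (m * m)) hδ hD hdδ hdD (fun n => by
        have h2 := hQ n
        have h3 := hz0 n
        rw [abs_div, abs_of_pos (mul_pos h2 h3)]
        gcongr
        exacts [g.norm_coe_le_norm n, hQm n, h1 n]) (a / w 0)
    refine ⟨ofNormedAddCommGroupDiscrete (fun n => w n * η n) (W * M) fun n => ?_, ?_⟩
    · rw [norm_mul, Real.norm_of_nonneg (hw0 n).le]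
      exact mul_le_mul ((hwQ n).trans (hzW n)) (hM n) (norm_nonneg _) hW0.le
    · refine Prod.ext ?_ ?_
      · change w 0 * η 0 = a
        rw [hη0, mul_div_cancel₀ _ (hw0 0).ne']
      · ext n
        rw [hL]
        simp only [coe_ofNormedAddCommGroupDiscrete]
        rw [hws', hws n,
          linearized_recurrence_iff (hP n) (hQ n) (hz0 n) rfl (hrec n)]
        exact hη n

theorem exists_pos_le_of_tendsto {u : ℕ → ℝ} {l : ℝ} (hu : ∀ n, 0 < u n) (hl : 0 < l)
    (h : Tendsto u atTop (𝓝 l)) : ∃ m, 0 < m ∧ ∀ n, m ≤ u n := by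
  obtain ⟨M, hM⟩ := (h.inv₀ hl.ne').bddAbove_range
  have hM' : ∀ n, (u n)⁻¹ ≤ M := fun n => hM ⟨n, rfl⟩
  have h0 : 0 < M := (inv_pos.2 (hu 0)).trans_le (hM' 0)
  exact ⟨M⁻¹, inv_pos.2 h0, fun n => inv_le_of_inv_le₀ (hu n) (hM' n)⟩

/-- A zero of the recurrence defect is an orbit. -/
theorem iterate_eq_of_orbitDefect_eq (hα : 0 < α) (hB : 0 < B) {z : ℕ →ᵇ ℝ} {t : ℝ}
    (hz : orbitDefect α A B z = (t, 0)) (hpos : ∀ n, 0 < A + z n) (n : ℕ) :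
    (systemMap α A B)^[n] (α / (A + t), z 1) = (α / (A + z n), z (n + 1)) := by
  induction n with
  | zero =>
    have : z 0 = t := congrArg Prod.fst hz
    simp [this]
  | succ n ih =>
    rw [Function.iterate_succ_apply', ih]
    have h1 : z (n + 2) * (B * (A + z n) + α) - z (n + 1) * (A + z n) = 0 :=
      congrArg (fun q : ℝ × (ℕ →ᵇ ℝ) => q.2 n) hz
    have h2 := hpos n
    simp only [systemMap, Prod.mk.injEq, true_and]
    rw [div_eq_iff (by positivity)]
    field_simp
    linarith

/-- Near `x₀` the curve is read off from the smooth local inverse of `orbitDefect` at the orbit of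
`(x₀, C x₀)`: nearby zeros of the defect are orbits with second coordinates bounded and bounded
away from `0`, hence orbits attracted by the interior equilibrium. -/
theorem IsSeparatrixFunction.contDiffAt {C : ℝ → ℝ} (hC : IsSeparatrixFunction α A B C)
    (hα : 0 < α) (hA : 0 < A) (hB : 0 < B) (h : 1 < B + α / A) (hB' : B < 1) {x₀ : ℝ}
    (hx₀ : 0 < x₀) : ContDiffAt ℝ ∞ C x₀ := by
  have hp : (x₀, C x₀) ∈ openQuadrant := ⟨hx₀, hC.pos x₀ hx₀⟩
  have ht : Tendsto (fun n : ℕ => ((systemMap α A B)^[n] (x₀, C x₀)).2) atTop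
      (𝓝 (α / (1 - B) - A)) := (continuous_snd.tendsto _).comp (hC.tendsto x₀ hx₀)
  obtain ⟨m', hm', hlow⟩ := exists_pos_le_of_tendsto
    (fun n => (iterate_mem_openQuadrant hα hA hB hp n).2) (interior_equilibrium_pos hA h hB') ht
  obtain ⟨M, hM⟩ := ht.bddAbove_range
  replace hM : ∀ n, ((systemMap α A B)^[n] (x₀, C x₀)).2 ≤ M := fun n => hM ⟨n, rfl⟩
  -- the sequence of second coordinates, preceded by the virtual term `α / x₀ - A`
  let zf : ℕ → ℝ := fun n => n.casesOn (α / x₀ - A) fun k =>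
    ((systemMap α A B)^[k] (x₀, C x₀)).2
  let z : ℕ →ᵇ ℝ := ofNormedAddCommGroupDiscrete zf (max |α / x₀ - A| M) fun n => by
    cases n with
    | zero => exact le_max_left _ _
    | succ n =>
      refine le_trans (le_of_eq ?_) ((hM n).trans (le_max_right _ _))
      exact Real.norm_of_nonneg (iterate_mem_openQuadrant hα hA hB hp n).2.le
  have hz0 : z 0 = α / x₀ - A := rfl
  have hzs : ∀ n, z (n + 1) = ((systemMap α A B)^[n] (x₀, C x₀)).2 := fun n => rfl
  have hx0' : 0 < α / x₀ := by positivity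
  set m := min (α / x₀) m' with hmdef
  have hm : 0 < m := lt_min hx0' hm'
  have hm0 : m ≤ A + z 0 := by rw [hz0, add_sub_cancel]; exact min_le_left _ _
  have hms : ∀ n, m ≤ z (n + 1) := fun n => (min_le_right _ _).trans (hlow n)
  have hrec : ∀ n, z (n + 2) * (B * (A + z n) + α) = z (n + 1) * (A + z n) := by
    intro n
    cases n with
    | zero =>
      rw [hzs, hzs, hz0, iterate_succ_snd]
      simp only [Function.iterate_zero, id]
      field_simp
      ring
    | succ n =>
      rw [hzs, hzs, hzs, iterate_add_two_snd]
      have := (iterate_mem_openQuadrant hα hA hB hp n).2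
      field_simp
  let L : (ℕ →ᵇ ℝ) ≃L[ℝ] ℝ × (ℕ →ᵇ ℝ) := ContinuousLinearEquiv.ofBijective
    (orbitDefectDeriv α A B z)
    (LinearMap.ker_eq_bot.2 (bijective_orbitDefectDeriv hα hA hB hm hm0 hms hrec).1)
    (LinearMap.range_eq_top.2 (bijective_orbitDefectDeriv hα hA hB hm hm0 hms hrec).2)
  have hL : HasFDerivAt (orbitDefect α A B) (L : (ℕ →ᵇ ℝ) →L[ℝ] ℝ × (ℕ →ᵇ ℝ)) z := by
    rw [ContinuousLinearEquiv.coe_ofBijective]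
    exact hasFDerivAt_orbitDefect z
  have hcd : ContDiffAt ℝ ∞ (orbitDefect α A B) z := contDiff_orbitDefect.contDiffAt
  have hΦ : orbitDefect α A B z = (α / x₀ - A, 0) := by
    refine Prod.ext rfl ?_
    ext n
    exact sub_eq_zero.2 (hrec n)
  have hstrict := hcd.hasStrictFDerivAt' hL (by simp)
  set g := hcd.localInverse hL (by simp) with hg
  have hgcd : ContDiffAt ℝ ∞ g (α / x₀ - A, 0) := hΦ ▸ hcd.to_localInverse hL (by simp)
  have hright : ∀ᶠ q in 𝓝 (α / x₀ - A, (0 : ℕ →ᵇ ℝ)), orbitDefect α A B (g q) = q :=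
    hΦ ▸ hstrict.eventually_right_inverse
  have hgz : g (α / x₀ - A, 0) = z := hΦ ▸ hcd.localInverse_apply_image hL (by simp)
  have hclose : ∀ᶠ q in 𝓝 (α / x₀ - A, (0 : ℕ →ᵇ ℝ)), dist (g q) z < m / 2 := by
    have := hgcd.continuousAt.eventually_mem (Metric.ball_mem_nhds _ (half_pos hm))
    rwa [hgz] at this
  have hι : ContDiffAt ℝ ∞ (fun x : ℝ => (α / x - A, (0 : ℕ →ᵇ ℝ))) x₀ := by
    have := hx₀.ne'
    fun_prop (disch := assumption)
  have hιt := hι.continuousAt.tendsto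
  have hcomp : ContDiffAt ℝ ∞ (fun x : ℝ => g (α / x - A, 0) 1) x₀ := by
    have h1 : ContDiffAt ℝ ∞ (fun x : ℝ => g (α / x - A, 0)) x₀ := hgcd.comp x₀ hι
    exact h1.continuousLinearMap_comp (evalCLM ℝ (1 : ℕ))
  refine hcomp.congr_of_eventuallyEq ?_
  filter_upwards [hιt.eventually hright, hιt.eventually hclose, lt_mem_nhds hx₀] with x hx1 hx2 hx
  set z' := g (α / x - A, 0)
  have hd : ∀ n, |z' n - z n| < m / 2 := fun n => (dist_coe_le_dist n).trans_lt hx2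
  have hpos' : ∀ n, m / 2 ≤ z' (n + 1) := fun n => by
    linarith [(abs_lt.1 (hd (n + 1))).1, hms n]
  have hApos : ∀ n, 0 < A + z' n := fun n => by
    cases n with
    | zero => linarith [(abs_lt.1 (hd 0)).1]
    | succ n => linarith [hpos' n]
  have horb := iterate_eq_of_orbitDefect_eq hα hB hx1 hApos
  have hx' : α / (A + (α / x - A)) = x := by rw [add_sub_cancel]; field_simp
  rw [hx'] at horb
  have h1 : 0 < z' 1 := (half_pos hm).trans_le (hpos' 0)
  refine ((hC.tendsto_interior_iff hα hA hB h hB' hx h1).1 ?_).symm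
  refine tendsto_interior_of_bounds hα hA hB h hB' ⟨hx, h1⟩ (half_pos hm) (M := ‖z'‖)
    (fun n => ?_) fun n => ?_
  · rw [horb]; exact hpos' n
  · rw [horb]; exact (le_abs_self _).trans (z'.norm_coe_le_norm _)

end Smooth

/-! ### The separatrix -/

section Separatrix

variable {α A B : ℝ} {C : ℝ → ℝ}

theorem IsSeparatrixFunction.graph_eq_stableManifold (hC : IsSeparatrixFunction α A B C)
    (hα : 0 < α) (hA : 0 < A) (hB : 0 < B) (h : 1 < B + α / A) (hB' : B < 1) :
    {p : ℝ × ℝ | p ∈ openQuadrant ∧ p.2 = C p.1} =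
      stableManifold (systemMap α A B) openQuadrant (1 - B, α / (1 - B) - A) := by
  ext ⟨x, y⟩
  refine and_congr_right fun hp => ?_
  exact (hC.tendsto_interior_iff hα hA hB h hB' hp.1 hp.2).symm

theorem IsSeparatrixFunction.above_iff (hC : IsSeparatrixFunction α A B C)
    (hα : 0 < α) (hA : 0 < A) (hB : 0 < B) (h : 1 < B + α / A) (hB' : B < 1) {p : ℝ × ℝ}
    (hp : p ∈ openQuadrant) : C p.1 < p.2 ↔ TendsToZeroInfinity (systemMap α A B) p := by
  refine ⟨hC.tendsToZeroInfinity hα hA hB h hB' hp.1, fun ht => ?_⟩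
  by_contra! hle
  rcases hle.eq_or_lt with h1 | h1
  · exact ht.not_tendsto ((hC.tendsto_interior_iff hα hA hB h hB' hp.1 hp.2).2 h1)
  · exact ht.not_tendsto (hC.tendsto_extinction hα hA hB h hB' hp.1 hp.2.le h1)

theorem IsSeparatrixFunction.below_iff (hC : IsSeparatrixFunction α A B C)
    (hα : 0 < α) (hA : 0 < A) (hB : 0 < B) (h : 1 < B + α / A) (hB' : B < 1) {p : ℝ × ℝ}
    (hp : p ∈ openQuadrant) : p.2 < C p.1 ↔
      Tendsto (fun n : ℕ => (systemMap α A B)^[n] p) atTop (𝓝 (α / A, 0)) := by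
  refine ⟨hC.tendsto_extinction hα hA hB h hB' hp.1 hp.2.le, fun ht => ?_⟩
  by_contra! hle
  rcases hle.eq_or_lt with h1 | h1
  · have := tendsto_nhds_unique ht
      ((hC.tendsto_interior_iff hα hA hB h hB' hp.1 hp.2).2 h1.symm)
    exact absurd (congrArg Prod.snd this) (interior_equilibrium_pos hA h hB').ne
  · exact (hC.tendsToZeroInfinity hα hA hB h hB' hp.1 h1).not_tendsto ht

theorem IsSeparatrixFunction.isInvariantSeparatrix (hC : IsSeparatrixFunction α A B C)
    (hα : 0 < α) (hA : 0 < A) (hB : 0 < B) (h : 1 < B + α / A) (hB' : B < 1) :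
    IsInvariantSeparatrix (systemMap α A B) openQuadrant
      {p : ℝ × ℝ | p ∈ openQuadrant ∧ p.2 = C p.1}
      {p : ℝ × ℝ | p ∈ openQuadrant ∧ C p.1 < p.2}
      {p : ℝ × ℝ | p ∈ openQuadrant ∧ p.2 < C p.1} := by
  have hcont : ContinuousOn C (Ioi 0) := fun x hx =>
    (hC.contDiffAt hα hA hB h hB' hx).continuousAt.continuousWithinAt
  have hopen : IsOpen openQuadrant :=
    (isOpen_lt continuous_const continuous_fst).inter (isOpen_lt continuous_const continuous_snd)
  have hdiff : ContinuousOn (fun p : ℝ × ℝ => p.2 - C p.1) openQuadrant :=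
    continuousOn_snd.sub (hcont.comp continuousOn_fst fun p hp => hp.1)
  have hT : ∀ p ∈ openQuadrant, systemMap α A B p ∈ openQuadrant := fun p hp =>
    systemMap_mem_openQuadrant hα hA hB hp
  refine ⟨fun p hp => hp.1, fun p hp => ?_, ?_, ?_, ?_, ?_, ?_, ?_, fun p hp => ?_, fun p hp => ?_⟩
  · rw [hC.graph_eq_stableManifold hα hA hB h hB'] at hp ⊢
    exact ⟨hT p hp.1, (tendsto_iterate_shift 1).2 hp.2⟩
  · ext p
    constructor
    · rintro ⟨hp, hne⟩
      rcases lt_trichotomy p.2 (C p.1) with h1 | h1 | h1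
      · exact Or.inr ⟨hp, h1⟩
      · exact (hne ⟨hp, h1⟩).elim
      · exact Or.inl ⟨hp, h1⟩
    · rintro (⟨hp, h1⟩ | ⟨hp, h1⟩)
      · exact ⟨hp, fun h2 => h1.ne' h2.2⟩
      · exact ⟨hp, fun h2 => h1.ne h2.2⟩
  · exact Set.disjoint_left.2 fun p hp hp' => lt_asymm hp.2 hp'.2
  · convert! hdiff.isOpen_inter_preimage hopen (isOpen_Ioi (a := 0)) using 1
    ext p
    simp
  · convert! hdiff.isOpen_inter_preimage hopen (isOpen_Iio (a := 0)) using 1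
    ext p
    simp
  · -- the region above the curve is parametrized by the vertical distance to it
    have himg : {p : ℝ × ℝ | p ∈ openQuadrant ∧ C p.1 < p.2} =
        (fun q : ℝ × ℝ => (q.1, C q.1 + q.2)) '' (Ioi 0 ×ˢ Ioi 0) := by
      ext ⟨x, y⟩
      constructor
      · rintro ⟨hp, h1⟩
        exact ⟨(x, y - C x), ⟨hp.1, sub_pos.2 h1⟩, by simp⟩
      · rintro ⟨⟨u, s⟩, ⟨hu, hs⟩, he⟩
        simp only [Prod.mk.injEq, mem_Ioi] at he hu hs
        obtain ⟨rfl, rfl⟩ := he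
        have := hC.pos u hu
        exact ⟨⟨hu, by dsimp only; positivity⟩, by dsimp only; linarith⟩
    rw [himg]
    refine (isConnected_Ioi.prod isConnected_Ioi).image _ ?_
    have h1 : ContinuousOn (fun q : ℝ × ℝ => C q.1) (Ioi 0 ×ˢ Ioi 0) :=
      hcont.comp continuousOn_fst fun q hq => hq.1
    exact continuousOn_fst.prodMk (h1.add continuousOn_snd)
  · -- the region below the curve is parametrized by the fraction of its height
    have himg : {p : ℝ × ℝ | p ∈ openQuadrant ∧ p.2 < C p.1} =
        (fun q : ℝ × ℝ => (q.1, C q.1 * q.2)) '' (Ioi 0 ×ˢ Ioo 0 1) := by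
      ext ⟨x, y⟩
      constructor
      · rintro ⟨hp, h1⟩
        have hCx := hC.pos x hp.1
        exact ⟨(x, y / C x), ⟨hp.1, div_pos hp.2 hCx, (div_lt_one hCx).2 h1⟩,
          by simp [mul_div_cancel₀ _ hCx.ne']⟩
      · rintro ⟨⟨u, s⟩, ⟨hu, hs, hs'⟩, he⟩
        simp only [Prod.mk.injEq, mem_Ioi] at he hu hs hs'
        obtain ⟨rfl, rfl⟩ := he
        have := hC.pos u hu
        exact ⟨⟨hu, by dsimp only; positivity⟩, mul_lt_of_lt_one_right this hs'⟩
    rw [himg]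
    refine (isConnected_Ioi.prod (isConnected_Ioo one_pos)).image _ ?_
    have h1 : ContinuousOn (fun q : ℝ × ℝ => C q.1) (Ioi 0 ×ˢ Ioo 0 1) :=
      hcont.comp continuousOn_fst fun q hq => hq.1
    exact continuousOn_fst.prodMk (h1.mul continuousOn_snd)
  · refine ⟨hT p hp.1, ?_⟩
    rw [hC.above_iff hα hA hB h hB' (hT p hp.1)]
    exact (tendsToZeroInfinity_shift 1).2 ((hC.above_iff hα hA hB h hB' hp.1).1 hp.2)
  · refine ⟨hT p hp.1, ?_⟩
    rw [hC.below_iff hα hA hB h hB' (hT p hp.1)]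
    exact (tendsto_iterate_shift 1).2 ((hC.below_iff hα hA hB h hB' hp.1).1 hp.2)

end Separatrix

/-! ### Global dynamics -/

theorem theorem6 (α₁ A₁ A₂ : ℝ) (hα₁ : 0 < α₁) (hA₁ : 0 < A₁) (hA₂ : 0 < A₂) :
    (1 ≤ A₂ →
      equilibria (systemMap α₁ A₁ A₂) closedQuadrant = {(α₁ / A₁, 0)} ∧
      IsGloballyAsymptoticallyStable (systemMap α₁ A₁ A₂) closedQuadrant (α₁ / A₁, 0)) ∧
    (A₂ + α₁ / A₁ < 1 →
      equilibria (systemMap α₁ A₁ A₂) closedQuadrant = {(α₁ / A₁, 0)} ∧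
      IsSaddle (systemMap α₁ A₁ A₂) (α₁ / A₁, 0) ∧
      stableManifold (systemMap α₁ A₁ A₂) closedQuadrant (α₁ / A₁, 0) = horizontalAxis ∧
      ∀ p ∈ closedQuadrant, p ∉ horizontalAxis →
        TendsToZeroInfinity (systemMap α₁ A₁ A₂) p) ∧
    (A₂ + α₁ / A₁ = 1 →
      equilibria (systemMap α₁ A₁ A₂) closedQuadrant = {(α₁ / A₁, 0)} ∧
      IsNonhyperbolic (systemMap α₁ A₁ A₂) (α₁ / A₁, 0) ∧
      basin (systemMap α₁ A₁ A₂) closedQuadrant (α₁ / A₁, 0) = horizontalAxis ∧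
      ∀ p ∈ closedQuadrant, p ∉ horizontalAxis →
        TendsToZeroInfinity (systemMap α₁ A₁ A₂) p) ∧
    (1 < A₂ + α₁ / A₁ → A₂ < 1 →
      equilibria (systemMap α₁ A₁ A₂) closedQuadrant =
        {(α₁ / A₁, 0), (1 - A₂, α₁ / (1 - A₂) - A₁)} ∧
      ((α₁ / A₁, 0) : ℝ × ℝ) ≠ (1 - A₂, α₁ / (1 - A₂) - A₁) ∧
      IsLocallyAsymptoticallyStable (systemMap α₁ A₁ A₂) closedQuadrant (α₁ / A₁, 0) ∧
      IsSaddle (systemMap α₁ A₁ A₂) (1 - A₂, α₁ / (1 - A₂) - A₁) ∧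
      ∃ C : ℝ → ℝ,
        MapsTo C (Ioi 0) (Ioi 0) ∧
        StrictMonoOn C (Ioi 0) ∧
        ContDiffOn ℝ ∞ C (Ioi 0) ∧
        {p : ℝ × ℝ | p ∈ openQuadrant ∧ p.2 = C p.1} =
          stableManifold (systemMap α₁ A₁ A₂) openQuadrant (1 - A₂, α₁ / (1 - A₂) - A₁) ∧
        IsInvariantSeparatrix (systemMap α₁ A₁ A₂) openQuadrant
          {p : ℝ × ℝ | p ∈ openQuadrant ∧ p.2 = C p.1}
          {p : ℝ × ℝ | p ∈ openQuadrant ∧ C p.1 < p.2}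
          {p : ℝ × ℝ | p ∈ openQuadrant ∧ p.2 < C p.1} ∧
        (∀ x₀ y₀ : ℝ, 0 < x₀ → 0 ≤ y₀ →
          (C x₀ < y₀ → TendsToZeroInfinity (systemMap α₁ A₁ A₂) (x₀, y₀)) ∧
          (y₀ = C x₀ → Tendsto (fun n : ℕ => (systemMap α₁ A₁ A₂)^[n] (x₀, y₀)) atTop
            (𝓝 (1 - A₂, α₁ / (1 - A₂) - A₁))) ∧
          (y₀ < C x₀ → Tendsto (fun n : ℕ => (systemMap α₁ A₁ A₂)^[n] (x₀, y₀)) atTop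
            (𝓝 (α₁ / A₁, 0)))) ∧
        (∀ y₀ x₁ y₁ : ℝ, 0 ≤ y₀ → (x₁, y₁) = systemMap α₁ A₁ A₂ (0, y₀) →
          (C x₁ < y₁ → TendsToZeroInfinity (systemMap α₁ A₁ A₂) (0, y₀)) ∧
          (y₁ = C x₁ → Tendsto (fun n : ℕ => (systemMap α₁ A₁ A₂)^[n] (0, y₀)) atTop
            (𝓝 (1 - A₂, α₁ / (1 - A₂) - A₁))) ∧
          (y₁ < C x₁ → Tendsto (fun n : ℕ => (systemMap α₁ A₁ A₂)^[n] (0, y₀)) atTop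
            (𝓝 (α₁ / A₁, 0))))) := by
  refine ⟨fun h => ?_, fun h => ?_, fun h => ?_, fun h h' => ?_⟩
  · exact ⟨equilibria_eq_singleton hα₁ hA₁ hA₂ (Or.inr h),
      isGloballyAsymptoticallyStable_axis hα₁ hA₁ h⟩
  · exact ⟨equilibria_eq_singleton hα₁ hA₁ hA₂ (Or.inl h.le), isSaddle_axis hα₁ hA₁ hA₂ h,
      basin_eq_horizontalAxis hα₁ hA₁ hA₂ h.le,
      fun p hp hp' => tendsToZeroInfinity_of_notMem_horizontalAxis hα₁ hA₁ hA₂ h.le hp hp'⟩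
  · exact ⟨equilibria_eq_singleton hα₁ hA₁ hA₂ (Or.inl h.le), isNonhyperbolic_axis hA₁ h,
      basin_eq_horizontalAxis hα₁ hA₁ hA₂ h.le,
      fun p hp hp' => tendsToZeroInfinity_of_notMem_horizontalAxis hα₁ hA₁ hA₂ h.le hp hp'⟩
  · obtain ⟨C, hC⟩ := exists_isSeparatrixFunction hα₁ hA₁ hA₂ h h'
    have main : ∀ x₀ y₀ : ℝ, 0 < x₀ → 0 ≤ y₀ →
        (C x₀ < y₀ → TendsToZeroInfinity (systemMap α₁ A₁ A₂) (x₀, y₀)) ∧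
        (y₀ = C x₀ → Tendsto (fun n : ℕ => (systemMap α₁ A₁ A₂)^[n] (x₀, y₀)) atTop
          (𝓝 (1 - A₂, α₁ / (1 - A₂) - A₁))) ∧
        (y₀ < C x₀ → Tendsto (fun n : ℕ => (systemMap α₁ A₁ A₂)^[n] (x₀, y₀)) atTop
          (𝓝 (α₁ / A₁, 0))) := fun x₀ y₀ hx hy =>
      ⟨hC.tendsToZeroInfinity hα₁ hA₁ hA₂ h h' hx, fun he => he ▸ hC.tendsto x₀ hx,
        hC.tendsto_extinction hα₁ hA₁ hA₂ h h' hx hy⟩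
    refine ⟨equilibria_eq_pair hα₁ hA₁ hA₂ h h', fun he => ?_,
      isLocallyAsymptoticallyStable_axis hα₁ hA₁ hA₂ h, isSaddle_interior hα₁ hA₁ hA₂ h h',
      C, fun x hx => hC.pos x hx, hC.strictMonoOn hα₁ hA₁ hA₂ h h',
      fun x hx => (hC.contDiffAt hα₁ hA₁ hA₂ h h' hx).contDiffWithinAt,
      hC.graph_eq_stableManifold hα₁ hA₁ hA₂ h h', hC.isInvariantSeparatrix hα₁ hA₁ hA₂ h h',
      main, fun y₀ x₁ y₁ hy he => ?_⟩
    · exact (interior_equilibrium_pos hA₁ h h').ne (congrArg Prod.snd he)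
    · have hx₁ : 0 < x₁ := by
        have e : x₁ = α₁ / (A₁ + y₀) := congrArg Prod.fst he
        rw [e]
        positivity
      have hy₁ : 0 ≤ y₁ := by
        have e : y₁ = y₀ / (A₂ + 0) := congrArg Prod.snd he
        rw [e]
        positivity
      have hm := main x₁ y₁ hx₁ hy₁
      rw [he] at hm
      exact ⟨fun hlt => (tendsToZeroInfinity_shift 1).1 (hm.1 hlt),
        fun heq => (tendsto_iterate_shift 1).1 (hm.2.1 heq),
        fun hlt => (tendsto_iterate_shift 1).1 (hm.2.2 hlt)⟩
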